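/- A circular order on a set $X$ is a ternary relation $[a,b,c]$ on $X$ such that: (i) $[a,b,c]$ implies $[b,c,a]$; (ii) $[a,b,c]$ implies that $[b,a,c]$ fails; (iii) $[a,b,c]$ and $[a,c,d]$ imply $[a,b,d]$; (iv) if $a,b,c$ are distinct, then $[a,b,c]$ or $[a,c,b]$. Its interval topology is the topology generated by $X$ and the complements of the closed arcs $[a,b]=\{a,b\}\cup\{x : [a,x,b]\}$, where $a,b\in X$ (possibly $a=b$). An action of a group $G$ on a topological space $Y$ is called circularly ordered if the topology of $Y$ is the interval topology of some circular order on $Y$ that is preserved by every element of $G$. Let $\mathbb{Q}_\circ=\mathbb{Q}/\mathbb{Z}\subset\mathbb{R}/\mathbb{Z}$ be the set of rational points of the circle with its natural circular order, and let $G=\mathrm{Aut}(\mathbb{Q}_\circ)$ be the group of all permutations of $\mathbb{Q}_\circ$ that preserve the circular order. Then for every action of $G$ by homeomorphisms on a nonempty compact metric space $X$ there is a nonempty closed $G$-invariant subset $Y\subseteq X$ such that the restricted action of $G$ on $Y$ (with the subspace topology) is circularly ordered. In other words, the discrete group $\mathrm{Aut}(\mathbb{Q}_\circ)$ is metrically intrinsically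 c-ordered: every continuous action of this discrete topological group on a nonempty compact metrizable space has a nonempty closed $G$-invariant subset on which the restricted action is circularly ordered. -/

import Mathlib

universe u v

/-- A (strict, total) circular order on `X`, as a ternary relation `R a b c`, written `[a,b,c]`. -/
structure IsCircularOrder {X : Type*} (R : X → X → X → Prop) : Prop where
  cyclic : ∀ a b c, R a b c → R b c a
  asymm : ∀ a b c, R a b c → ¬ R b a c
  trans : ∀ a b c d, R a b c → R a c d → R a b d
  total : ∀ a b c, a ≠ b → b ≠ c → a ≠ c → R a b c ∨ R a c b

/-- The closed arc `[a,b]`, consisting of `a`, `b` and all `x` with `[a,x,b]`. -/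
def closedArc {X : Type*} (R : X → X → X → Prop) (a b : X) : Set X :=
  {x | R a x b} ∪ {a, b}

/-- The interval topology of a circular order: generated by the whole space and the complements
of the closed arcs `[a,b]` (including the degenerate arcs `[a,a] = {a}`). -/
abbrev circularIntervalTopology {X : Type*} (R : X → X → X → Prop) : TopologicalSpace X :=
  TopologicalSpace.generateFrom ({U | ∃ a b : X, U = (closedArc R a b)ᶜ} ∪ {Set.univ})

/-- The action of `G` on the topological space `Y` is circularly ordered: the topology of `Y` is
the interval topology of a circular order that is preserved by every element of `G`. -/
def IsCircularlyOrderedSystem (G Y : Type*) [Group G] [TopologicalSpace Y] [MulAction G Y] :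
    Prop :=
  ∃ R : Y → Y → Y → Prop, IsCircularOrder R ∧
    (inferInstance : TopologicalSpace Y) = circularIntervalTopology R ∧
    ∀ (g : G) (a b c : Y), R a b c → R (g • a) (g • b) (g • c)

/-- The action of `G` on `X` has a (nonempty) closed invariant subset on which the restricted
action, with the subspace topology, is circularly ordered. -/
def HasCircularlyOrderedSubsystem (G X : Type*) [Group G] [TopologicalSpace X] [MulAction G X] :
    Prop :=
  ∃ Y : SubMulAction G X, (Y : Set X).Nonempty ∧ IsClosed (Y : Set X) ∧
    IsCircularlyOrderedSystem G Y

/-- A topological group `(G, τ)` is metrically intrinsically c-ordered if every continuous action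
of it on a (nonempty) compact metrizable space has a circularly ordered closed subsystem. -/
def MetricallyIntrinsicallyCOrdered (G : Type v) [Group G] (τ : TopologicalSpace G) :
    Prop :=
  ∀ (X : Type u) [TopologicalSpace X] [CompactSpace X] [TopologicalSpace.MetrizableSpace X]
    [Nonempty X] [MulAction G X] [ContinuousSMul G X], HasCircularlyOrderedSubsystem G X

/-- The group of automorphisms of a set with a ternary relation: the permutations that preserve
the relation in both directions. -/
def ternaryAut {X : Type*} (R : X → X → X → Prop) : Subgroup (Equiv.Perm X) where
  carrier := {g | ∀ a b c, R (g a) (g b) (g c) ↔ R a b c}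
  mul_mem' := fun {f g} hf hg a b c => (hf (g a) (g b) (g c)).trans (hg a b c)
  one_mem' := fun _ _ _ => Iff.rfl
  inv_mem' := fun {g} hg a b c => by
    simpa using (hg (g⁻¹ a) (g⁻¹ b) (g⁻¹ c)).symm

/-- The rational points of the circle, `ℚ / ℤ`. -/
abbrev RationalCircle : Type := AddCircle (1 : ℚ)

/-- The natural circular order of `ℚ / ℤ`: going around the circle in the positive direction
from `a`, one meets `b` strictly before `c`, and `a`, `b`, `c` are distinct. -/
def RationalCircle.order (a b c : RationalCircle) : Prop := sbtw a b c

theorem RationalCircle.isCircularOrder : IsCircularOrder RationalCircle.order where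
  cyclic _ _ _ h := h.cyclic_left
  asymm _ _ _ h h' := h.not_sbtw h'.cyclic_right
  trans _ _ _ _ h h' := (h.cyclic_left.trans_left h'.cyclic_left).cyclic_right
  total a b c hab hbc hac := by
    unfold RationalCircle.order
    by_contra! h
    obtain ⟨h₁, h₂⟩ := h
    rw [sbtw_iff_not_btw, not_not] at h₁ h₂
    rcases btw_antisymm h₁ (h₂.cyclic_left.cyclic_left) with h | h | h
    · exact hbc h.symm
    · exact hab h.symm
    · exact hac h

/-- The group of circular order automorphisms of `ℚ / ℤ`. -/
abbrev AutRationalCircle : Type := ternaryAut RationalCircle.order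

/-! The obstacle is that the group is discrete, so nothing is assumed about how the action depends
on the group element. This is overcome by automatic continuity. Since X is compact metric, C(X,X) is
separable, so the maximal displacement of a group element is a separable length function on the
group (`isSeparableLength_displacement`). Every such length on Aut(ℚ,<) is continuous for pointwise
convergence (`RatAut.exists_finset_lt`). The reason is that a category argument makes a small ball
dense in the stabilizer of a finite set, and that stabilizer is a finite power of Aut(ℚ,<). In such
a power, diagonalization over disjoint blocks, pigeonhole on powers and a commutator swindle turn
density into a uniform bound.

Continuity combined with Ramsey's theorem yields a fixed point for Aut(ℚ,<) in X, which is extreme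
amenability in this setting (`RatAut.exists_fixed`). The stabilizer of a point o of the circle is a
copy of Aut(ℚ,<), so a point of X fixed by it spreads to an equivariant map φ from the circle to X.
By continuity again, φ varies little on arcs that miss a suitable finite set, so it has one-sided
limits. The limits from the left form an equivariant left continuous map ψ
(`exists_leftContinuous`).

Since the stabilizer of a point is transitive on the other points, ψ is constant or injective. If it
is constant, its value is a global fixed point. If it is injective, Y is the closure of its image,
and three points of Y are declared ordered when all nearby triples from the image are. The crux is
totality. Half-open arcs that are apart have images with disjoint closures
(`disjoint_closure_image_arcIoc`), so orientation cannot flip near a point of X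
(`exists_nhds_no_flip`). Closed arcs are then closed in Y, and comparing a compact topology with a
Hausdorff one identifies the subspace topology with the interval topology. -/

/-! ### Order automorphisms of the rationals -/

/-- The group of order automorphisms of the rationals. -/
abbrev RatAut : Type := ℚ ≃o ℚ

namespace RatAut

/-- Back-and-forth as a genericity argument: an ideal of finite partial isomorphisms that meets the
cofinal sets "defined at a" and "a is a value" is a full automorphism. Countably many further
cofinal sets cost nothing; they carry the category argument of `exists_finset_dense`. -/
theorem exists_extension_meeting (p : Order.PartialIso ℚ ℚ) {ι : Type} [Encodable ι]
    (D : ι → Order.Cofinal (Order.PartialIso ℚ ℚ)) :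
    ∃ g : RatAut, (∀ q ∈ p.val, g q.1 = q.2) ∧
      ∀ n, ∃ r ∈ D n, ∀ q ∈ r.val, g q.1 = q.2 := by
  let toCofinal : (ℚ ⊕ ℚ) ⊕ ι → Order.Cofinal (Order.PartialIso ℚ ℚ) := fun z ↦
    Sum.elim (Sum.elim (Order.PartialIso.definedAtLeft ℚ) (Order.PartialIso.definedAtRight ℚ)) D z
  let I : Order.Ideal (Order.PartialIso ℚ ℚ) := Order.idealOfCofinals p toCofinal
  let F a := Order.PartialIso.funOfIdeal a I
    (Order.cofinal_meets_idealOfCofinals _ toCofinal (Sum.inl (Sum.inl a)))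
  let G b := Order.PartialIso.invOfIdeal b I
    (Order.cofinal_meets_idealOfCofinals _ toCofinal (Sum.inl (Sum.inr b)))
  have key : ∀ r ∈ I, ∀ q ∈ r.val, (F q.1).val = q.2 := by
    intro r hr q hq
    obtain ⟨f, hf, ha⟩ := (F q.1).prop
    obtain ⟨m, _, fm, rm⟩ := I.directed _ hf _ hr
    have h := m.prop (q.1, _) (fm ha) q (rm hq)
    rw [cmp_self_eq_eq] at h
    exact cmp_eq_eq_iff _ _ |>.1 h.symm
  refine ⟨OrderIso.ofCmpEqCmp (fun a ↦ (F a).val) (fun b ↦ (G b).val) fun a b ↦ ?_,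
    fun q hq ↦ key p (Order.mem_idealOfCofinals p toCofinal) q hq, fun n ↦ ?_⟩
  · rcases (F a).prop with ⟨f, hf, ha⟩
    rcases (G b).prop with ⟨g, hg, hb⟩
    rcases I.directed _ hf _ hg with ⟨m, _, fm, gm⟩
    exact m.prop (a, _) (fm ha) (_, b) (gm hb)
  · obtain ⟨r, hr, hrI⟩ := Order.cofinal_meets_idealOfCofinals p toCofinal (Sum.inr n)
    exact ⟨r, hr, fun q hq ↦ key r hrI q hq⟩

/-- The finite partial isomorphism given by a strictly monotone function on a finite set. -/
def partialIsoOfStrictMonoOn (s : Finset ℚ) (f : ℚ → ℚ) (hf : StrictMonoOn f s) :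
    Order.PartialIso ℚ ℚ :=
  ⟨s.image fun x ↦ (x, f x), by
    intro p hp q hq
    obtain ⟨x, hx, rfl⟩ := Finset.mem_image.1 hp
    obtain ⟨y, hy, rfl⟩ := Finset.mem_image.1 hq
    exact (hf.cmp_map_eq hx hy).symm⟩

theorem exists_eq_on_finset (s : Finset ℚ) (f : ℚ → ℚ) (hf : StrictMonoOn f s) :
    ∃ g : RatAut, ∀ x ∈ s, g x = f x := by
  obtain ⟨g, hg, -⟩ := exists_extension_meeting (partialIsoOfStrictMonoOn s f hf)
    (ι := Empty) (fun n ↦ n.elim)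
  exact ⟨g, fun x hx ↦ hg (x, f x) (Finset.mem_image_of_mem _ hx)⟩

theorem exists_map_pair {p q p' q' : ℚ} (h : p < q) (h' : p' < q') :
    ∃ g : RatAut, g p = p' ∧ g q = q' := by
  obtain ⟨g, hg⟩ := exists_eq_on_finset {p, q} (fun x ↦ if x = p then p' else q') (by
    intro x hx y hy hxy
    simp only [Finset.coe_insert, Finset.coe_singleton, Set.mem_insert_iff,
      Set.mem_singleton_iff] at hx hy
    rcases hx with rfl | rfl <;> rcases hy with rfl | rfl
    · exact absurd hxy (lt_irrefl _)
    · simpa [h.ne'] using h'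
    · exact absurd (hxy.trans h) (lt_irrefl _)
    · exact absurd hxy (lt_irrefl _))
  exact ⟨g, by simpa using hg p (by simp), by simpa [h.ne'] using hg q (by simp)⟩

theorem exists_image_eq {s t : Finset ℚ} (h : s.card = t.card) :
    ∃ g : RatAut, s.image g = t := by
  have hst := h
  let e : s ≃o t := (s.orderIsoOfFin h).symm.trans (t.orderIsoOfFin rfl)
  obtain ⟨g, hg⟩ := exists_eq_on_finset s (fun x ↦ if hx : x ∈ s then e ⟨x, hx⟩ else 0) (by
    intro x hx y hy hxy
    have hx' : x ∈ s := hx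
    have hy' : y ∈ s := hy
    simp only [hx', hy', dite_true]
    exact e.strictMono hxy)
  refine ⟨g, Finset.eq_of_subset_of_card_le ?_ ?_⟩
  · intro y hy
    obtain ⟨x, hx, rfl⟩ := Finset.mem_image.1 hy
    rw [hg x hx, dif_pos hx]
    exact (e ⟨x, hx⟩).2
  · rw [Finset.card_image_of_injective _ g.injective, hst]

/-- A finite linear order is rigid, so setwise and pointwise stabilizers coincide. Hence cosets of
the stabilizer of a finite set correspond to finite subsets of that size, which is what lets
Ramsey's theorem apply. -/
theorem apply_eq_self_of_image_eq {s : Finset ℚ} {g : RatAut} (h : s.image g = s) :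
    ∀ x ∈ s, g x = x := by
  have hu := Finset.orderEmbOfFin_unique (s := s) rfl (f := fun i ↦ g (s.orderEmbOfFin rfl i))
    (fun i ↦ by
      have : g (s.orderEmbOfFin rfl i) ∈ s.image g :=
        Finset.mem_image_of_mem _ (s.orderEmbOfFin_mem rfl i)
      rwa [h] at this)
    (fun i j hij ↦ g.strictMono ((s.orderEmbOfFin rfl).strictMono hij))
  intro x hx
  have : x ∈ Set.range (s.orderEmbOfFin rfl) := by
    rw [Finset.range_orderEmbOfFin]; exact hx
  obtain ⟨i, rfl⟩ := this
  exact congrFun hu i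

/-! ### Gluing along tilings -/

theorem exists_tile {a : ℤ → ℚ} (ha : StrictMono a) (hu : ∀ x, ∃ k, x < a k)
    (hl : ∀ x, ∃ k, a k ≤ x) (x : ℚ) : ∃ k, a k ≤ x ∧ x < a (k + 1) := by
  obtain ⟨b, hb⟩ := hu x
  obtain ⟨k, hk, hm⟩ := Int.exists_greatest_of_bdd (P := fun k ↦ a k ≤ x)
    ⟨b, fun z hz ↦ (ha.lt_iff_lt.1 (lt_of_le_of_lt hz hb)).le⟩ (hl x)
  exact ⟨k, hk, not_le.1 fun h ↦ by have := hm _ h; omega⟩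

theorem exists_eq_on_tiles {a b : ℤ → ℚ} (ha : StrictMono a) (hau : ∀ x, ∃ k, x < a k)
    (hal : ∀ x, ∃ k, a k ≤ x) (hb : StrictMono b) (hbu : ∀ x, ∃ k, x < b k)
    (hbl : ∀ x, ∃ k, b k ≤ x) (f : ℤ → RatAut) (hf : ∀ k, f k (a k) = b k)
    (hf' : ∀ k, f k (a (k + 1)) = b (k + 1)) :
    ∃ g : RatAut, ∀ k, ∀ x ∈ Set.Icc (a k) (a (k + 1)), g x = f k x := by
  choose i hi hi' using exists_tile ha hau hal
  have hmono : StrictMono fun x ↦ f (i x) x := by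
    intro x y hxy
    have hle : i x ≤ i y := by
      by_contra! h
      have h1 : a (i y + 1) ≤ a (i x) := ha.monotone h
      exact absurd (h1.trans (hi x)) (not_le.2 (hxy.trans (hi' y)))
    rcases hle.eq_or_lt with h | h
    · simp only [h]; exact (f (i y)).strictMono hxy
    · calc f (i x) x < f (i x) (a (i x + 1)) := (f (i x)).strictMono (hi' x)
        _ = b (i x + 1) := hf' _
        _ ≤ b (i y) := hb.monotone h
        _ = f (i y) (a (i y)) := (hf _).symm
        _ ≤ f (i y) y := (f (i y)).monotone (hi y)
  have huniq : ∀ k x, a k ≤ x → x < a (k + 1) → i x = k := by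
    intro k x h h'
    have h1 := ha.lt_iff_lt.1 ((hi x).trans_lt h')
    have h2 := ha.lt_iff_lt.1 (h.trans_lt (hi' x))
    omega
  have hsurj : Function.Surjective fun x ↦ f (i x) x := by
    intro y
    obtain ⟨k, hk, hk'⟩ := exists_tile hb hbu hbl y
    refine ⟨(f k).symm y, ?_⟩
    have : i ((f k).symm y) = k := by
      apply huniq
      · rw [← hf k] at hk; exact (f k).le_symm_apply.2 hk
      · rw [← hf' k] at hk'; exact (f k).symm_apply_lt.2 hk'
    simp [this]
  refine ⟨hmono.orderIsoOfSurjective _ hsurj, fun k x hx ↦ ?_⟩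
  rw [StrictMono.coe_orderIsoOfSurjective]
  rcases hx.2.eq_or_lt with h | h
  · have : i x = k + 1 := huniq _ _ h.ge (h ▸ ha (by omega))
    simp only [this]
    rw [h, hf, hf']
  · simp only [huniq k x hx.1 h]

/-! ### Block systems -/

/-- A family of disjoint convex blocks of `ℚ`, each with a coordinate in `ℚ`, together with the
action of the product of copies of `RatAut` on these blocks. -/
structure BlockSystem (K : Type) where
  hom : (K → RatAut) →* RatAut
  emb : K → ℚ → ℚ
  strictMono : ∀ k, StrictMono (emb k)
  exists_emb_eq : ∀ k t t' x, emb k t ≤ x → x ≤ emb k t' → ∃ y, emb k y = x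
  hom_emb : ∀ a k t, hom a (emb k t) = emb k (a k t)
  hom_of_forall_ne : ∀ a x, (∀ k t, x ≠ emb k t) → hom a x = x
  -- The bounds s, t keep the support of g inside each block, so g need not be assumed to preserve
  -- blocks. Taking t k < s k is allowed and forces a trivial coordinate.
  lift : ∀ (s t : K → ℚ) (g : RatAut),
    (∀ x, (∀ k, ∀ y ∈ Set.Icc (s k) (t k), x ≠ emb k y) → g x = x) →
    ∃ a, hom a = g ∧ ∀ k, ∀ y ∉ Set.Icc (s k) (t k), a k y = y

/-- Fibres of a monotone map are convex, and those without endpoints are countable dense orders,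
hence copies of ℚ by Cantor's theorem. Acting independently on the chosen fibres and trivially
elsewhere stays monotone because π is preserved. -/
theorem exists_blockSystem {ι K : Type} [LinearOrder ι] (π : ℚ → ι) (hπ : Monotone π) (idx : K → ι)
    (hidx : Function.Injective idx) (hne : ∀ k, ∃ x, π x = idx k)
    (hup : ∀ x k, π x = idx k → ∃ y > x, π y = idx k)
    (hdown : ∀ x k, π x = idx k → ∃ y < x, π y = idx k) :
    ∃ B : BlockSystem K, (∀ k t, π (B.emb k t) = idx k) ∧
      (∀ k x, π x = idx k → ∃ t, B.emb k t = x) ∧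
      (∀ a x, (∀ k, π x ≠ idx k) → B.hom a x = x) ∧
      ∀ g : RatAut, (∀ x, π (g x) = π x) → (∀ x, (∀ k, π x ≠ idx k) → g x = x) →
        ∃ a, B.hom a = g := by
  classical
  have hE : ∀ k, Nonempty (ℚ ≃o {x : ℚ // π x = idx k}) := by
    intro k
    have : Nonempty {x : ℚ // π x = idx k} := let ⟨x, hx⟩ := hne k; ⟨⟨x, hx⟩⟩
    have : NoMaxOrder {x : ℚ // π x = idx k} :=
      ⟨fun x ↦ let ⟨y, hy, hy'⟩ := hup x k x.2; ⟨⟨y, hy'⟩, hy⟩⟩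
    have : NoMinOrder {x : ℚ // π x = idx k} :=
      ⟨fun x ↦ let ⟨y, hy, hy'⟩ := hdown x k x.2; ⟨⟨y, hy'⟩, hy⟩⟩
    have : DenselyOrdered {x : ℚ // π x = idx k} := ⟨fun x y hxy ↦ by
      obtain ⟨z, hz, hz'⟩ := exists_between (show (x : ℚ) < y from hxy)
      exact ⟨⟨z, le_antisymm ((hπ hz'.le).trans y.2.le) (x.2.ge.trans (hπ hz.le))⟩, hz, hz'⟩⟩
    exact Order.iso_of_countable_dense _ _
  let E : ∀ k, ℚ ≃o {x : ℚ // π x = idx k} := fun k ↦ (hE k).some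
  have hEπ : ∀ k t, π (E k t) = idx k := fun k t ↦ (E k t).2
  have hEmono : ∀ k, StrictMono fun t ↦ (E k t : ℚ) := fun k s t h ↦ (E k).strictMono h
  have hEsurj : ∀ k x, π x = idx k → ∃ t, (E k t : ℚ) = x :=
    fun k x hx ↦ ⟨(E k).symm ⟨x, hx⟩, by simp⟩
  let F : (K → RatAut) → ℚ → ℚ := fun a x ↦
    if h : ∃ k, π x = idx k then
      (E h.choose (a h.choose ((E h.choose).symm ⟨x, h.choose_spec⟩))).1
    else x
  have hF : ∀ a k t, F a (E k t) = E k (a k t) := by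
    intro a k t
    have h : ∃ k', π (E k t) = idx k' := ⟨k, hEπ k t⟩
    have hk : h.choose = k := hidx (h.choose_spec.symm.trans (hEπ k t))
    have aux : ∀ (k' : K) (h' : π (E k t) = idx k'), k' = k →
        (E k' (a k' ((E k').symm ⟨E k t, h'⟩)) : ℚ) = E k (a k t) := by
      rintro k' h' rfl
      simp
    simp only [F, dif_pos h]
    exact aux _ _ hk
  have hF' : ∀ a x, (∀ k, π x ≠ idx k) → F a x = x := by
    intro a x hx
    simp only [F]
    rw [dif_neg (by simpa using hx)]
  have hcases : ∀ x : ℚ, (∃ k t, x = (E k t : ℚ)) ∨ ∀ k, π x ≠ idx k := by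
    intro x
    by_cases h : ∃ k, π x = idx k
    · obtain ⟨k, hk⟩ := h
      obtain ⟨t, ht⟩ := hEsurj k x hk
      exact Or.inl ⟨k, t, ht.symm⟩
    · exact Or.inr (by simpa using h)
  have hFπ : ∀ a x, π (F a x) = π x := by
    intro a x
    rcases hcases x with ⟨k, t, rfl⟩ | h
    · rw [hF, hEπ, hEπ]
    · rw [hF' a x h]
  have hFmono : ∀ a, StrictMono (F a) := by
    intro a x y hxy
    rcases (hπ hxy.le).eq_or_lt with h | h
    · rcases hcases x with ⟨k, t, rfl⟩ | hx
      · obtain ⟨t', rfl⟩ := hEsurj k y (by rw [← h, hEπ])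
        rw [hF, hF]
        exact hEmono k ((a k).strictMono ((hEmono k).lt_iff_lt.1 hxy))
      · rwa [hF' a x hx, hF' a y (by rwa [← h])]
    · rw [← hFπ a x, ← hFπ a y] at h
      exact not_le.1 fun h' ↦ absurd (hπ h') (not_le.2 h)
  have hFmul : ∀ a b x, F a (F b x) = F (a * b) x := by
    intro a b x
    rcases hcases x with ⟨k, t, rfl⟩ | h
    · rw [hF, hF, hF]; rfl
    · rw [hF' b x h, hF' a x h, hF' _ x h]
  have hFone : ∀ x, F 1 x = x := by
    intro x
    rcases hcases x with ⟨k, t, rfl⟩ | h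
    · rw [hF]; rfl
    · exact hF' _ x h
  let Φ : (K → RatAut) →* RatAut :=
    { toFun := fun a ↦ (hFmono a).orderIsoOfRightInverse _ (F a⁻¹) fun x ↦ by
        rw [hFmul, mul_inv_cancel, hFone]
      map_one' := by ext x; exact hFone x
      map_mul' := fun a b ↦ by ext x; exact (hFmul a b x).symm }
  have hΦ : ∀ a x, Φ a x = F a x := fun a x ↦ rfl
  have hlift : ∀ g : RatAut, (∀ x, π (g x) = π x) → (∀ x, (∀ k, π x ≠ idx k) → g x = x) →
        ∃ a, Φ a = g := by
    intro g hg hg'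
    have hm : ∀ k, StrictMono fun t ↦ (E k).symm ⟨g (E k t), by rw [hg, hEπ]⟩ := fun k s t h ↦
      (E k).symm.strictMono (g.strictMono (hEmono k h))
    have hs : ∀ k, Function.Surjective fun t ↦ (E k).symm ⟨g (E k t), by rw [hg, hEπ]⟩ := by
      intro k t
      obtain ⟨s, hs⟩ := hEsurj k (g.symm (E k t)) (by rw [← hg, g.apply_symm_apply, hEπ])
      refine ⟨s, ?_⟩
      simp [hs]
    let a : K → RatAut := fun k ↦ (hm k).orderIsoOfSurjective _ (hs k)
    have ha : ∀ k t, a k t = (E k).symm ⟨g (E k t), by rw [hg, hEπ]⟩ := fun k t ↦ rfl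
    refine ⟨a, ?_⟩
    ext x
    rw [hΦ]
    rcases hcases x with ⟨k, t, rfl⟩ | h
    · rw [hF, ha]; simp
    · rw [hF' a x h, hg' x h]
  refine ⟨⟨Φ, fun k t ↦ E k t, hEmono, fun k t t' x h h' ↦ hEsurj k x
    (le_antisymm ((hπ h').trans_eq (hEπ k _)) ((hEπ k _).symm.trans_le (hπ h))), fun a k t ↦ hF a k t,
    fun a x h ↦ hF' a x fun k hk ↦ let ⟨t, ht⟩ := hEsurj k x hk; h k t ht.symm, ?_⟩, hEπ, hEsurj,
    fun a x h ↦ hF' a x h, hlift⟩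
  intro s t g hg
  have hg' : ∀ x, (∀ k, π x ≠ idx k) → g x = x := fun x hx ↦
    hg x fun k y _ h ↦ hx k (by rw [h, hEπ])
  have hout : ∀ k y, y ∉ Set.Icc (s k) (t k) → g (E k y) = E k y := by
    refine fun k y hy ↦ hg _ fun k' y' hy' h ↦ hy ?_
    have hk : k = k' := hidx (by rw [← hEπ k y, h, hEπ])
    subst hk
    rwa [(hEmono k).injective h]
  obtain ⟨a, ha⟩ := hlift g (fun x ↦ by
    rcases hcases x with ⟨k, y, rfl⟩ | h
    -- Two points of the same block on either side of y and beyond the support are fixed by g, and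
    -- they trap the image of `E k y` in that block.
    · have h1 : g (E k (min y (s k) - 1)) = E k (min y (s k) - 1) := hout _ _ fun h ↦ by
        have := h.1; have := min_le_right y (s k); linarith
      have h2 : g (E k (max y (t k) + 1)) = E k (max y (t k) + 1) := hout _ _ fun h ↦ by
        have := h.2; have := le_max_right y (t k); linarith
      have h3 : g (E k (min y (s k) - 1)) ≤ g (E k y) := g.monotone ((hEmono k).monotone (by
        have := min_le_left y (s k); linarith))
      have h4 : g (E k y) ≤ g (E k (max y (t k) + 1)) := g.monotone ((hEmono k).monotone (by
        have := le_max_left y (t k); linarith))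
      rw [h1] at h3
      rw [h2] at h4
      rw [hEπ]
      apply le_antisymm
      · exact (hπ h4).trans_eq (hEπ k _)
      · exact (hEπ k _).symm.trans_le (hπ h3)
    · rw [hg' x h]) hg'
  refine ⟨a, ha, fun k y hy ↦ (hEmono k).injective ?_⟩
  rw [← hF, ← hΦ, ha, hout k y hy]

/-- The image of a block system under an order automorphism. -/
def BlockSystem.conj {K : Type} (B : BlockSystem K) (θ : RatAut) : BlockSystem K where
  hom := (MulAut.conj θ⁻¹).toMonoidHom.comp B.hom
  emb k t := θ⁻¹ (B.emb k t)
  strictMono k _ _ h := (θ⁻¹).strictMono (B.strictMono k h)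
  exists_emb_eq k t t' x h h' := by
    obtain ⟨y, hy⟩ := B.exists_emb_eq k t t' (θ x) (by
      have := θ.monotone h; rwa [RelIso.apply_inv_self] at this) (by
      have := θ.monotone h'; rwa [RelIso.apply_inv_self] at this)
    exact ⟨y, by rw [hy, RelIso.inv_apply_self]⟩
  hom_emb a k t := by
    change θ⁻¹ (B.hom a ((θ⁻¹)⁻¹ (θ⁻¹ (B.emb k t)))) = _
    rw [RelIso.inv_apply_self, B.hom_emb]
  hom_of_forall_ne a x h := by
    change θ⁻¹ (B.hom a ((θ⁻¹)⁻¹ x)) = x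
    rw [inv_inv, B.hom_of_forall_ne, RelIso.inv_apply_self]
    exact fun k t hk ↦ h k t (by rw [← hk, RelIso.inv_apply_self])
  lift s t g hg := by
    obtain ⟨a, ha, ha'⟩ := B.lift s t (θ * g * θ⁻¹) fun x hx ↦ by
      have := hg (θ⁻¹ x) fun k y hy h ↦ hx k y hy ((θ⁻¹).injective h)
      rw [RelIso.mul_apply, RelIso.mul_apply, this, RelIso.apply_inv_self]
    refine ⟨a, ?_, ha'⟩
    change θ⁻¹ * B.hom a * (θ⁻¹)⁻¹ = g
    rw [ha]; group

end RatAut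

namespace RatAut

/-- The monotone function ⌊x⌋ + ⌈x⌉ is even at integers, so its odd fibres are exactly the open unit
intervals. -/
theorem floor_add_ceil_eq_iff (x : ℚ) (k : ℤ) :
    ⌊x⌋ + ⌈x⌉ = 2 * k + 1 ↔ (k : ℚ) < x ∧ x < k + 1 := by
  constructor
  · intro h
    have h1 := Int.ceil_le_floor_add_one x
    have h2 := Int.floor_le_ceil x
    have h3 : ⌊x⌋ = k := by omega
    have h4 : ⌈x⌉ = k + 1 := by omega
    have h5 : k < ⌈x⌉ := by omega
    have h6 : ⌊x⌋ < k + 1 := by omega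
    exact ⟨Int.lt_ceil.1 h5, by exact_mod_cast Int.floor_lt.1 h6⟩
  · rintro ⟨h, h'⟩
    have h3 : ⌊x⌋ = k := Int.floor_eq_iff.2 ⟨h.le, h'⟩
    have h4 : ⌈x⌉ = k + 1 := Int.ceil_eq_iff.2 ⟨by push_cast; linarith, by push_cast; linarith⟩
    omega

theorem exists_unit_blocks {K : Type} (f : K → ℤ) (hf : Function.Injective f) :
    ∃ B : BlockSystem K, (∀ k t, (f k : ℚ) < B.emb k t ∧ B.emb k t < f k + 1) ∧
      ∀ k x, (f k : ℚ) < x → x < f k + 1 → ∃ t, B.emb k t = x := by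
  obtain ⟨B, h1, h2, -⟩ := exists_blockSystem (fun x : ℚ ↦ ⌊x⌋ + ⌈x⌉)
    (fun x y h ↦ add_le_add (Int.floor_mono h) (Int.ceil_mono h)) (fun k : K ↦ 2 * f k + 1)
    (fun a b h ↦ hf (by simpa using h))
    (fun k ↦ ⟨f k + 1 / 2, (floor_add_ceil_eq_iff _ _).2 ⟨by linarith, by linarith⟩⟩)
    (fun x k h ↦ by
      obtain ⟨h1, h2⟩ := (floor_add_ceil_eq_iff _ _).1 h
      obtain ⟨y, hy, hy'⟩ := exists_between h2
      exact ⟨y, hy, (floor_add_ceil_eq_iff _ _).2 ⟨h1.trans hy, hy'⟩⟩)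
    (fun x k h ↦ by
      obtain ⟨h1, h2⟩ := (floor_add_ceil_eq_iff _ _).1 h
      obtain ⟨y, hy, hy'⟩ := exists_between h1
      exact ⟨y, hy', (floor_add_ceil_eq_iff _ _).2 ⟨hy, hy'.trans h2⟩⟩)
  exact ⟨B, fun k t ↦ (floor_add_ceil_eq_iff _ _).1 (h1 k t),
    fun k x h h' ↦ h2 k x ((floor_add_ceil_eq_iff _ _).2 ⟨h, h'⟩)⟩

/-- The blocks are the finitely many gaps of A, so the pointwise stabilizer of A is a finite power
of `RatAut`. Counting the points of A below x, once strictly and once weakly, is constant on gaps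
and separates them from the points of A. -/
theorem exists_finset_blocks (A : Finset ℚ) :
    ∃ (K : Type) (_ : Finite K) (B : BlockSystem K), (∀ a, ∀ x ∈ A, B.hom a x = x) ∧
      ∀ g : RatAut, (∀ x ∈ A, g x = x) → ∃ a, B.hom a = g := by
  classical
  let π : ℚ → ℕ := fun x ↦ (A.filter (· < x)).card + (A.filter (· ≤ x)).card
  have hπ : Monotone π := fun x y h ↦ add_le_add
    (Finset.card_le_card (Finset.monotone_filter_right _ fun a _ ha ↦ lt_of_lt_of_le ha h))
    (Finset.card_le_card (Finset.monotone_filter_right _ fun a _ ha ↦ le_trans ha h))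
  have hmem : ∀ x ∈ A, ∀ y ∉ A, π x ≠ π y := by
    intro x hx y hy
    rcases lt_trichotomy x y with h | h | h
    · refine ne_of_lt (add_lt_add_of_lt_of_le (Finset.card_lt_card ?_) (Finset.card_le_card
        (Finset.monotone_filter_right _ fun a _ ha ↦ le_trans ha h.le)))
      refine Finset.ssubset_iff_of_subset
        (Finset.monotone_filter_right _ fun a _ ha ↦ lt_trans ha h) |>.2 ⟨x, ?_, ?_⟩
      · simp [hx, h]
      · simp
    · exact absurd (h ▸ hx) hy
    · refine ne_of_gt (add_lt_add_of_le_of_lt (Finset.card_le_card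
        (Finset.monotone_filter_right _ fun a _ ha ↦ lt_trans ha h)) (Finset.card_lt_card ?_))
      refine Finset.ssubset_iff_of_subset
        (Finset.monotone_filter_right _ fun a _ ha ↦ le_trans ha h.le) |>.2 ⟨x, ?_, ?_⟩
      · simp [hx]
      · simp [h]
  have hconst : ∀ x y, (∀ a ∈ A, (a < x ↔ a < y)) → (∀ a ∈ A, (a ≤ x ↔ a ≤ y)) → π x = π y := by
    intro x y h h'
    simp only [π]
    rw [Finset.filter_congr h, Finset.filter_congr h']
  let K : Type := {i : ℕ // ∃ x ∉ A, π x = i}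
  have hK : Finite K := by
    refine Set.Finite.to_subtype ((Set.finite_Iic (A.card + A.card)).subset ?_)
    rintro _ ⟨x, -, rfl⟩
    exact add_le_add (Finset.card_filter_le _ _) (Finset.card_filter_le _ _)
  have hnot : ∀ x (k : K), π x = k.1 → x ∉ A := by
    rintro x ⟨_, y, hy, rfl⟩ h hx
    exact hmem x hx y hy h
  obtain ⟨B, -, -, h3, h4⟩ := exists_blockSystem π hπ (fun k : K ↦ k.1) Subtype.val_injective
    (fun k ↦ let ⟨x, _, hx'⟩ := k.2; ⟨x, hx'⟩)
    (fun x k h ↦ by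
      obtain ⟨y, hy, hy'⟩ := Order.exists_between_finsets {x} (A.filter (x < ·)) (by simp)
      have hxy : x < y := hy x (by simp)
      have hxA := hnot x k h
      refine ⟨y, hxy, h ▸ hconst _ _ (fun a ha ↦ ⟨fun h ↦ ?_, fun h ↦ h.trans hxy⟩)
        fun a ha ↦ ⟨fun h ↦ ?_, fun h ↦ h.trans hxy.le⟩⟩
      · by_contra! h'
        have : x ≠ a := fun h ↦ hxA (h ▸ ha)
        exact absurd (hy' a (by simp [ha, lt_of_le_of_ne h' this])) (not_lt.2 h.le)
      · by_contra! h'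
        exact absurd (hy' a (by simp [ha, h'])) (not_lt.2 h))
    (fun x k h ↦ by
      obtain ⟨y, hy, hy'⟩ := Order.exists_between_finsets (A.filter (· < x)) {x} (by simp)
      have hxy : y < x := hy' x (by simp)
      have hxA := hnot x k h
      refine ⟨y, hxy, h ▸ hconst _ _ (fun a ha ↦ ⟨fun h ↦ h.trans hxy, fun h ↦ ?_⟩)
        fun a ha ↦ ⟨fun h ↦ h.trans hxy.le, fun h ↦ ?_⟩⟩
      · exact hy a (by simp [ha, h])
      · have : a ≠ x := fun h ↦ hxA (h ▸ ha)
        exact (hy a (by simp [ha, lt_of_le_of_ne h this])).le)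
  refine ⟨K, hK, B, fun a x hx ↦ h3 a x fun k hk ↦ hnot x k hk hx, fun g hg ↦ h4 g ?_ ?_⟩
  · refine fun x ↦ hconst _ _ (fun a ha ↦ ?_) fun a ha ↦ ?_
    · conv_lhs => rw [← hg a ha]
      exact g.lt_iff_lt
    · conv_lhs => rw [← hg a ha]
      exact g.le_iff_le
  · intro x hx
    by_contra h
    exact hx ⟨π x, x, fun hxA ↦ h (hg x hxA), rfl⟩ rfl

/-! ### Translations and the commutator swindle -/

/-- The translation by `1`. -/
def shift : RatAut := OrderIso.addRight 1

theorem shift_zpow_apply (m : ℤ) (x : ℚ) : (shift ^ m) x = x + m := by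
  have hn : ∀ (n : ℕ) x, (shift ^ n) x = x + n := by
    intro n
    induction n with
    | zero => intro x; simp
    | succ n ih =>
      intro x
      rw [pow_succ, RelIso.mul_apply, ih]
      simp only [shift, OrderIso.addRight_apply]
      push_cast; ring
  cases m with
  | ofNat n => simpa using hn n x
  | negSucc n =>
    apply (shift ^ (n + 1)).injective
    rw [zpow_negSucc, RelIso.apply_inv_self, hn]
    push_cast; ring

/-- Infinite swindle: let v be the product of the disjoint translates of u by km for all k ≥ 0.
Conjugating v by the translation drops only the factor k = 0, so the commutator is u. -/
theorem exists_commutator {u : RatAut} (hu : ∀ x ∉ Set.Icc (0 : ℚ) (1 / 2), u x = x) {m : ℤ}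
    (hm : 1 ≤ m) : ∃ v : RatAut, v * shift ^ m * v⁻¹ * (shift ^ m)⁻¹ = u := by
  have hmq : (1 : ℚ) ≤ m := by exact_mod_cast hm
  have hlow : ∀ x < (0 : ℚ), u x = x := fun x hx ↦ hu x fun h ↦ absurd h.1 (not_le.2 hx)
  have hhigh : ∀ x > (1 / 2 : ℚ), u x = x := fun x hx ↦ hu x fun h ↦ absurd h.2 (not_le.2 hx)
  -- The offset 1/4 puts the tile boundaries strictly between the supports [km, km + 1/2] of the
  -- translates.
  let a : ℤ → ℚ := fun k ↦ k * m - 1 / 4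
  have ha : StrictMono a := strictMono_int_of_lt_succ fun k ↦ by
    simp only [a]; push_cast; linarith
  have hau : ∀ x, ∃ k, x < a k := fun x ↦ by
    obtain ⟨n, hn⟩ := exists_nat_gt (|x| + 1)
    refine ⟨n, ?_⟩
    have : x ≤ |x| := le_abs_self x
    have h0 : (0 : ℚ) ≤ |x| := abs_nonneg x
    simp only [a]; push_cast
    nlinarith
  have hal : ∀ x, ∃ k, a k ≤ x := fun x ↦ by
    obtain ⟨n, hn⟩ := exists_nat_gt (|x| + 1)
    refine ⟨-n, ?_⟩
    have : -x ≤ |x| := neg_le_abs x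
    have h0 : (0 : ℚ) ≤ |x| := abs_nonneg x
    simp only [a]; push_cast
    nlinarith
  let f : ℤ → RatAut := fun k ↦ if 0 ≤ k then shift ^ (k * m) * u * shift ^ (-(k * m)) else 1
  have hf0 : ∀ k x, 0 ≤ k → f k x = u (x - k * m) + k * m := by
    intro k x hk
    simp only [f, if_pos hk, RelIso.mul_apply, shift_zpow_apply]
    push_cast; rw [← sub_eq_add_neg]
  have hf1 : ∀ k x, k < 0 → f k x = x := by
    intro k x hk
    simp only [f, if_neg (not_le.2 hk), RelIso.one_apply]
  obtain ⟨v, hv⟩ := exists_eq_on_tiles ha hau hal ha hau hal f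
    (fun k ↦ by
      rcases le_or_gt 0 k with hk | hk
      · rw [hf0 k _ hk, hlow _ (by simp only [a]; linarith)]; ring
      · exact hf1 k _ hk)
    (fun k ↦ by
      rcases le_or_gt 0 k with hk | hk
      · rw [hf0 k _ hk, hhigh _ (by simp only [a]; push_cast; linarith)]; ring
      · exact hf1 k _ hk)
  refine ⟨v, ?_⟩
  rw [mul_inv_eq_iff_eq_mul, mul_inv_eq_iff_eq_mul]
  ext x
  simp only [RelIso.mul_apply, shift_zpow_apply]
  obtain ⟨k, hk, hk'⟩ := exists_tile ha hau hal x
  have hx' : x + m ∈ Set.Icc (a (k + 1)) (a (k + 1 + 1)) := by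
    simp only [a] at hk hk' ⊢; push_cast at hk hk' ⊢
    constructor <;> linarith
  rw [hv k x ⟨hk, hk'.le⟩, hv (k + 1) _ hx']
  rcases lt_trichotomy k (-1) with h | h | h
  · rw [hf1 _ _ (by omega), hf1 _ _ (by omega), hlow]
    have hkq : (k : ℚ) + 1 ≤ -1 := by exact_mod_cast (by omega : k + 1 ≤ -1)
    simp only [a] at hk'; push_cast at hk'
    nlinarith
  · subst h
    rw [hf0 _ _ (by omega), hf1 _ _ (by omega)]
    simp
  · have h0 : 0 ≤ k := by omega
    have hkq : (0 : ℚ) ≤ k := by exact_mod_cast h0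
    rw [hf0 _ _ (by omega), hf0 _ _ h0]
    have e : x + m - ((k + 1 : ℤ) : ℚ) * m = x - k * m := by push_cast; ring
    rw [e, hhigh (u (x - k * m) + k * m + m)]
    · push_cast; ring
    · have h1 : u (a 0) ≤ u (x - k * m) := u.monotone (by simp only [a] at hk ⊢; push_cast; linarith)
      rw [hlow _ (by simp [a])] at h1
      simp only [a] at h1; push_cast at h1
      nlinarith

/-- A homothety about the midpoint of [p,q] whose ratio already throws the complement of [p,q] off
[s,t]; higher powers only expand more. Uniformity in m is needed because the exponents from
`exists_zpow_lt` are not controlled. -/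
theorem exists_expansion {p q s t : ℚ} (hpq : p < q) :
    ∃ E : RatAut, ∀ m : ℤ, 1 ≤ m → ∀ y, (E ^ m) y ∈ Set.Icc s t → y ∈ Set.Icc p q := by
  set c := (p + q) / 2 with hc
  set w := (q - p) / 2 with hw
  have hw0 : 0 < w := by linarith
  set r := 1 + (|s - c| + |t - c|) / w with hr
  have hr1 : 1 ≤ r := by
    have : 0 ≤ (|s - c| + |t - c|) / w := by positivity
    linarith
  let E : RatAut := (OrderIso.addRight (-c)).trans
    ((OrderIso.mulRight₀ r (by linarith)).trans (OrderIso.addRight c))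
  have hE : ∀ y, E y = (y - c) * r + c := fun y ↦ by
    simp only [E, OrderIso.trans_apply, OrderIso.addRight_apply, OrderIso.mulRight₀_apply]
    ring
  have hEn : ∀ n : ℕ, ∀ y, (E ^ n) y = (y - c) * r ^ n + c := by
    intro n
    induction n with
    | zero => intro y; simp
    | succ n ih => intro y; rw [pow_succ, RelIso.mul_apply, ih, hE]; ring
  refine ⟨E, fun m hm y hy ↦ ?_⟩
  obtain ⟨n, rfl⟩ := Int.eq_ofNat_of_zero_le (by omega : 0 ≤ m)
  rw [zpow_natCast, hEn] at hy
  have hrn : r ≤ r ^ n := by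
    calc r = r ^ 1 := (pow_one r).symm
      _ ≤ r ^ n := pow_le_pow_right₀ hr1 (by omega)
  have hrw : r * w = w + (|s - c| + |t - c|) := by rw [hr]; field_simp
  have h1 : -|s - c| ≤ s - c := neg_abs_le _
  have h2 : t - c ≤ |t - c| := le_abs_self _
  have h3 := abs_nonneg (s - c)
  have h4 := abs_nonneg (t - c)
  have hy1 := hy.1
  have hy2 := hy.2
  constructor
  · by_contra! h
    have : y - c < -w := by linarith
    nlinarith
  · by_contra! h
    have : w < y - c := by linarith
    nlinarith

end RatAut

/-! ### Factoring automorphisms into pieces with local support -/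

namespace RatAut

/-- `g` is the identity around each point of a discrete sequence that is unbounded in both
directions. -/
def FixesDiscreteNhds (g : RatAut) : Prop :=
  ∃ l c u : ℤ → ℚ, (∀ k, l k < c k) ∧ (∀ k, c k < u k) ∧ StrictMono c ∧ (∀ x, ∃ k, x < c k) ∧
    (∀ x, ∃ k, c k ≤ x) ∧ ∀ k, ∀ x ∈ Set.Icc (l k) (u k), g x = x

/-- Conjugate the points c k to the integers. Then g fixes neighbourhoods of all integers, so it
acts inside the unit intervals with bounded support in each. -/
theorem FixesDiscreteNhds.exists_blockSystem {g : RatAut} (hg : FixesDiscreteNhds g) :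
    ∃ (B : BlockSystem ℤ) (a : ℤ → RatAut) (s t : ℤ → ℚ), B.hom a = g ∧
      ∀ k, ∀ y ∉ Set.Icc (s k) (t k), a k y = y := by
  obtain ⟨l, c, u, hl, hu, hc, hcu, hcl, hg⟩ := hg
  obtain ⟨B, hB, hB'⟩ := exists_unit_blocks (fun k : ℤ ↦ k) Function.injective_id
  have hz : StrictMono fun k : ℤ ↦ (k : ℚ) := Int.cast_strictMono
  choose f hf hf' using fun k : ℤ ↦ exists_map_pair (hc (lt_add_one k)) (hz (lt_add_one k))
  obtain ⟨θ, hθ⟩ := exists_eq_on_tiles hc hcu hcl hz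
    (fun x ↦ ⟨⌊x⌋ + 1, by push_cast; exact Int.lt_floor_add_one x⟩)
    (fun x ↦ ⟨⌊x⌋, Int.floor_le x⟩) f hf hf'
  have hθc : ∀ k, θ (c k) = k := fun k ↦ by
    rw [hθ k _ ⟨le_rfl, (hc (lt_add_one k)).le⟩, hf]
  have hs : ∀ k : ℤ, ∃ s, B.emb k s ≤ θ (u k) := fun k ↦ by
    have h1 : (k : ℚ) < θ (u k) := by rw [← hθc]; exact θ.strictMono (hu k)
    obtain ⟨y, hy, hy'⟩ := exists_between (lt_min h1 (lt_add_one (k : ℚ)))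
    obtain ⟨s, rfl⟩ := hB' k y hy (hy'.trans_le (min_le_right _ _))
    exact ⟨s, (hy'.trans_le (min_le_left _ _)).le⟩
  have ht : ∀ k : ℤ, ∃ t, θ (l (k + 1)) ≤ B.emb k t := fun k ↦ by
    have h1 : θ (l (k + 1)) < (k : ℚ) + 1 := by
      have := θ.strictMono (hl (k + 1)); rw [hθc] at this; push_cast at this; exact this
    obtain ⟨y, hy, hy'⟩ := exists_between (max_lt h1 (lt_add_one (k : ℚ)))
    obtain ⟨s, rfl⟩ := hB' k y ((le_max_right _ _).trans_lt hy) hy'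
    exact ⟨s, ((le_max_left _ _).trans_lt hy).le⟩
  choose s hs using hs
  choose t ht using ht
  obtain ⟨a, ha, ha'⟩ := (B.conj θ).lift s t g fun x hx ↦ by
    have hx : ∀ k, ∀ y ∈ Set.Icc (s k) (t k), θ x ≠ B.emb k y := fun k y hy h ↦
      hx k y hy (by
        change x = θ⁻¹ (B.emb k y)
        rw [← h, RelIso.inv_apply_self])
    obtain ⟨k, hk, hk'⟩ := exists_tile hc hcu hcl x
    rcases hk.eq_or_lt with h | h
    · exact hg k x ⟨h ▸ (hl k).le, h ▸ (hu k).le⟩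
    · have h1 : (k : ℚ) < θ x := by rw [← hθc]; exact θ.strictMono h
      have h2 : θ x < (k : ℚ) + 1 := by
        have := θ.strictMono hk'; rw [hθc] at this; push_cast at this; exact this
      obtain ⟨y, hy⟩ := hB' k _ h1 h2
      by_cases hys : y < s k
      · refine hg k x ⟨(hl k).le.trans hk, θ.le_iff_le.1 (le_trans ?_ (hs k))⟩
        rw [← hy]; exact ((B.strictMono k) hys).le
      · by_cases hyt : t k < y
        · refine hg (k + 1) x ⟨θ.le_iff_le.1 ((ht k).trans ?_), hk'.le.trans (hu _).le⟩
          rw [← hy]; exact ((B.strictMono k) hyt).le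
        · exact absurd hy.symm (hx k y ⟨not_lt.1 hys, not_lt.1 hyt⟩)
  exact ⟨B.conj θ, a, s, t, ha, ha'⟩

/-- Choose the points so sparse that g moves none of them past a neighbour; `step` dominates
everything that has to be jumped over. -/
theorem exists_interlacing (g : RatAut) :
    ∃ z : ℤ → ℚ, StrictMono z ∧ (∀ x, ∃ k, x < z k) ∧ (∀ x, ∃ k, z k ≤ x) ∧
      (∀ k, z k < g (z (k + 1))) ∧ ∀ k, g (z k) < z (k + 1) := by
  let step : ℚ → ℚ := fun b ↦
    1 + |b| + |g b| + |g.symm b| + |g (-b)| + |g.symm (-b)|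
  let b : ℕ → ℚ := fun n ↦ step^[n] 1
  have hb : ∀ n, b (n + 1) = step (b n) := fun n ↦ Function.iterate_succ_apply' _ _ _
  have hstep : ∀ y, y + 1 ≤ step y ∧ g y < step y ∧ g.symm y < step y ∧ -step y < g (-y) ∧
      -step y < g.symm (-y) := by
    intro y
    have h1 := abs_nonneg y
    have h2 := abs_nonneg (g y)
    have h3 := abs_nonneg (g.symm y)
    have h4 := abs_nonneg (g (-y))
    have h5 := abs_nonneg (g.symm (-y))
    have k1 := le_abs_self y
    have k2 := le_abs_self (g y)
    have k3 := le_abs_self (g.symm y)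
    have k4 := neg_abs_le (g (-y))
    have k5 := neg_abs_le (g.symm (-y))
    simp only [step]
    refine ⟨?_, ?_, ?_, ?_, ?_⟩ <;> linarith
  have hbn : ∀ n : ℕ, (n : ℚ) + 1 ≤ b n := by
    intro n
    induction n with
    | zero => simp [b]
    | succ n ih =>
      rw [hb]; push_cast
      have := (hstep (b n)).1
      linarith
  let z : ℤ → ℚ := fun k ↦ if 0 ≤ k then b k.toNat else -b k.natAbs
  have hz0 : ∀ n : ℕ, z n = b n := fun n ↦ by simp [z]
  have hz1 : ∀ n : ℕ, z (-(n + 1 : ℕ)) = -b (n + 1) := fun n ↦ by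
    simp only [z]
    rw [if_neg (by omega), show (-((n + 1 : ℕ) : ℤ)).natAbs = n + 1 by omega]
  have hcase : ∀ k : ℤ, (∃ n : ℕ, k = n) ∨ k = -1 ∨ ∃ n : ℕ, k = -(n + 1 + 1 : ℕ) := by
    intro k
    rcases le_or_gt 0 k with h | h
    · exact Or.inl ⟨k.toNat, by omega⟩
    · rcases eq_or_ne k (-1) with h' | h'
      · exact Or.inr (Or.inl h')
      · exact Or.inr (Or.inr ⟨(-k - 2).toNat, by omega⟩)
  have hzm : ∀ k, z k < z (k + 1) ∧ z k < g (z (k + 1)) ∧ g (z k) < z (k + 1) := by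
    intro k
    rcases hcase k with ⟨n, rfl⟩ | rfl | ⟨n, rfl⟩
    · have : ((n : ℤ) + 1) = (n + 1 : ℕ) := by push_cast; ring
      rw [this, hz0, hz0, hb]
      obtain ⟨h1, h2, h3, -, -⟩ := hstep (b n)
      exact ⟨by linarith, g.symm_apply_lt.1 h3, h2⟩
    · have e1 : z (-1) = -b 1 := hz1 0
      have e2 : z (-1 + 1) = b 0 := hz0 0
      rw [e1, e2, hb 0]
      obtain ⟨h1, h2, h3, h4, h5⟩ := hstep (b 0)
      have h0 := hbn 0
      have hlt : -b 0 < b 0 := by push_cast at h0; linarith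
      refine ⟨by linarith, h4.trans (g.strictMono hlt), ?_⟩
      exact g.lt_symm_apply.1 (h5.trans (g.symm.strictMono hlt))
    · have e1 : (-(n + 1 + 1 : ℕ) + 1 : ℤ) = -(n + 1 : ℕ) := by push_cast; ring
      rw [e1, hz1 (n + 1), hz1 n, hb (n + 1)]
      obtain ⟨h1, h2, h3, h4, h5⟩ := hstep (b (n + 1))
      exact ⟨by linarith, h4, g.lt_symm_apply.1 h5⟩
  refine ⟨z, strictMono_int_of_lt_succ fun k ↦ (hzm k).1, fun x ↦ ?_, fun x ↦ ?_,
    fun k ↦ (hzm k).2.1, fun k ↦ (hzm k).2.2⟩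
  · obtain ⟨n, hn⟩ := exists_nat_gt x
    exact ⟨n, by rw [hz0]; have := hbn n; linarith⟩
  · obtain ⟨n, hn⟩ := exists_nat_gt (-x)
    exact ⟨-(n + 1 : ℕ), by rw [hz1]; have := hbn (n + 1); push_cast at this; linarith⟩

/-- Let g₁ be the identity on the tiles with index 0 mod 4, equal to g on those with index 2 mod 4,
and interpolated on the odd tiles. Then g₁ fixes the first kind of tile and g₁⁻¹g the second. -/
theorem exists_mul_eq (g : RatAut) :
    ∃ g₁ g₂ : RatAut, g = g₁ * g₂ ∧ FixesDiscreteNhds g₁ ∧ FixesDiscreteNhds g₂ := by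
  obtain ⟨z, hz, hzu, hzl, hzg, hgz⟩ := exists_interlacing g
  -- The prescribed values of g₁ at tile endpoints; interlacing is exactly what makes them
  -- increasing.
  let b : ℤ → ℚ := fun k ↦ if k % 4 < 2 then z k else g (z k)
  have hb0 : ∀ k, k % 4 < 2 → b k = z k := fun k h ↦ if_pos h
  have hb1 : ∀ k, ¬ k % 4 < 2 → b k = g (z k) := fun k h ↦ if_neg h
  have hzz : ∀ k, z k < z (k + 1) := fun k ↦ hz (lt_add_one k)
  have hb : StrictMono b := strictMono_int_of_lt_succ fun k ↦ by
    by_cases h : k % 4 < 2 <;> by_cases h' : (k + 1) % 4 < 2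
    · rw [hb0 k h, hb0 _ h']; exact hzz k
    · rw [hb0 k h, hb1 _ h']; exact hzg k
    · rw [hb1 k h, hb0 _ h']; exact hgz k
    · rw [hb1 k h, hb1 _ h']; exact g.strictMono (hzz k)
  have hbz : ∀ k, z k < b (k + 1) := fun k ↦ by
    by_cases h' : (k + 1) % 4 < 2
    · rw [hb0 _ h']; exact hzz k
    · rw [hb1 _ h']; exact hzg k
  have hzb : ∀ k, b k < z (k + 1) := fun k ↦ by
    by_cases h' : k % 4 < 2
    · rw [hb0 _ h']; exact hzz k
    · rw [hb1 _ h']; exact hgz k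
  choose F hF hF' using fun k : ℤ ↦ exists_map_pair (hzz k) (hb (lt_add_one k))
  obtain ⟨g₁, hg₁⟩ := exists_eq_on_tiles hz hzu hzl hb
    (fun x ↦ let ⟨k, hk⟩ := hzu x; ⟨k + 1, hk.trans (hbz k)⟩)
    (fun x ↦ let ⟨k, hk⟩ := hzl x; ⟨k - 1, by
      have := hzb (k - 1); rw [sub_add_cancel] at this; exact (this.trans_le hk).le⟩)
    (fun k ↦ if k % 4 = 0 then 1 else if k % 4 = 2 then g else F k)
    (fun k ↦ by
      by_cases h : k % 4 = 0
      · rw [if_pos h, hb0 k (by omega), RelIso.one_apply]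
      · by_cases h2 : k % 4 = 2
        · rw [if_neg h, if_pos h2, hb1 k (by omega)]
        · rw [if_neg h, if_neg h2, hF])
    (fun k ↦ by
      by_cases h : k % 4 = 0
      · rw [if_pos h, hb0 _ (by omega), RelIso.one_apply]
      · by_cases h2 : k % 4 = 2
        · rw [if_neg h, if_pos h2, hb1 _ (by omega)]
        · rw [if_neg h, if_neg h2, hF'])
  have key : ∀ (h : RatAut) (r : ℤ), 0 ≤ r →
      (∀ j : ℤ, ∀ x ∈ Set.Icc (z (4 * j + r)) (z (4 * j + r + 1)), h x = x) →
      FixesDiscreteNhds h := by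
    intro h r hr hh
    refine ⟨fun j ↦ z (4 * j + r), fun j ↦ (z (4 * j + r) + z (4 * j + r + 1)) / 2,
      fun j ↦ z (4 * j + r + 1), fun k ↦ ?_, fun k ↦ ?_, strictMono_int_of_lt_succ fun j ↦ ?_,
      fun x ↦ ?_, fun x ↦ ?_, hh⟩
    · have := hzz (4 * k + r); linarith
    · have := hzz (4 * k + r); linarith
    · have h1 := hzz (4 * j + r)
      have h2 := hzz (4 * (j + 1) + r)
      have h3 : z (4 * j + r + 1) < z (4 * (j + 1) + r) := hz (by omega)
      linarith
    · obtain ⟨k, hk⟩ := hzu x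
      refine ⟨|k|, ?_⟩
      have h1 := hzz (4 * |k| + r)
      have h2 : z k ≤ z (4 * |k| + r) := hz.monotone (by have := le_abs_self k; have := abs_nonneg k; omega)
      linarith
    · obtain ⟨k, hk⟩ := hzl x
      refine ⟨-|k| - r - 1, ?_⟩
      have h1 := hzz (4 * (-|k| - r - 1) + r)
      have h2 : z (4 * (-|k| - r - 1) + r + 1) ≤ z k :=
        hz.monotone (by have := neg_abs_le k; have := abs_nonneg k; omega)
      linarith
  refine ⟨g₁, g₁⁻¹ * g, by group, key g₁ 0 le_rfl fun j x hx ↦ ?_,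
    key _ 2 (by norm_num) fun j x hx ↦ ?_⟩
  · rw [hg₁ _ x hx, if_pos (by omega), RelIso.one_apply]
  · rw [RelIso.mul_apply]
    apply g₁.injective
    rw [RelIso.apply_inv_self, hg₁ _ x hx, if_neg (by omega), if_pos (by omega)]

end RatAut

/-! ### Separable length functions -/

/-- A length function on a group for which the group is separable. -/
structure IsSeparableLength {P : Type*} [Group P] (N : P → ℝ) : Prop where
  map_one : N 1 = 0
  map_inv : ∀ g, N g⁻¹ = N g
  map_mul_le : ∀ g h, N (g * h) ≤ N g + N h
  separable : ∀ ε > 0, ∃ k : ℕ → P, ∀ g, ∃ n, N ((k n)⁻¹ * g) < ε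

namespace IsSeparableLength

variable {P : Type*} [Group P] {N : P → ℝ}

theorem inv_mul_lt (hN : IsSeparableLength N) {a b c : P} {ε : ℝ} (h : N (c⁻¹ * a) < ε)
    (h' : N (c⁻¹ * b) < ε) : N (a⁻¹ * b) < 2 * ε := by
  have h1 := hN.map_mul_le (c⁻¹ * a)⁻¹ (c⁻¹ * b)
  rw [hN.map_inv, show (c⁻¹ * a)⁻¹ * (c⁻¹ * b) = a⁻¹ * b by group] at h1
  linarith

theorem comp {Q : Type*} [Group Q] (hN : IsSeparableLength N) (f : Q →* P) :
    IsSeparableLength fun q ↦ N (f q) where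
  map_one := by rw [f.map_one, hN.map_one]
  map_inv g := by rw [f.map_inv, hN.map_inv]
  map_mul_le g h := by rw [f.map_mul]; exact hN.map_mul_le _ _
  separable ε hε := by
    classical
    obtain ⟨k, hk⟩ := hN.separable (ε / 2) (by positivity)
    -- The dense sequence need not lie in the image of f, so each term is replaced by a nearby image
    -- point if there is one.
    refine ⟨fun n ↦ if h : ∃ q, N ((k n)⁻¹ * f q) < ε / 2 then h.choose else 1, fun g ↦ ?_⟩
    obtain ⟨n, hn⟩ := hk (f g)
    have h : ∃ q, N ((k n)⁻¹ * f q) < ε / 2 := ⟨g, hn⟩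
    refine ⟨n, ?_⟩
    dsimp only
    rw [dif_pos h, f.map_mul, f.map_inv]
    have := hN.inv_mul_lt h.choose_spec hn
    linarith

theorem conj_le (hN : IsSeparableLength N) (s g : P) : N (s * g * s⁻¹) ≤ N g + 2 * N s := by
  have h1 := hN.map_mul_le (s * g) s⁻¹
  have h2 := hN.map_mul_le s g
  rw [hN.map_inv] at h1
  linarith

/-- Among countably many disjoint sets of coordinates there is one on which every element of a
product group agrees with a short element. -/
theorem exists_eq_on_fibre {J Γ : Type*} [Group Γ] {N : (J → Γ) → ℝ} (hN : IsSeparableLength N)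
    (c : J → ℕ) {ε : ℝ} (hε : 0 < ε) :
    ∃ n, ∀ g : J → Γ, ∃ f, N f < 2 * ε ∧ ∀ j, c j = n → f j = g j := by
  obtain ⟨k, hk⟩ := hN.separable ε hε
  have key : ∃ n, ∀ g : J → Γ, ∃ f, N ((k n)⁻¹ * f) < ε ∧ ∀ j, c j = n → f j = g j := by
    by_contra! h
    choose g hg using h
    -- Diagonal element: on each fibre n it equals the counterexample for n, yet it lies in one of
    -- the balls.
    obtain ⟨n, hn⟩ := hk fun j ↦ g (c j) j
    obtain ⟨j, hj, hne⟩ := hg n _ hn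
    exact hne (by rw [hj])
  obtain ⟨n, hn⟩ := key
  refine ⟨n, fun g ↦ ?_⟩
  obtain ⟨f, hf, hf'⟩ := hn g
  -- Dividing by an element of the same ball that is trivial on the fibre recentres the ball at the
  -- identity.
  obtain ⟨f₁, hf₁, hf₁'⟩ := hn 1
  refine ⟨f₁⁻¹ * f, hN.inv_mul_lt hf₁ hf, fun j hj ↦ ?_⟩
  rw [Pi.mul_apply, Pi.inv_apply, hf' j hj, hf₁' j hj]
  simp

/-- Every family has a short element of coordinatewise powers with eventually positive
exponents. -/
theorem exists_zpow_lt {J Γ : Type*} [Group Γ] {N : (J → Γ) → ℝ} (hN : IsSeparableLength N)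
    (l : J → ℕ) (E : J → Γ) {ε : ℝ} (hε : 0 < ε) :
    ∃ (m : J → ℤ) (M : ℕ), (∀ j, M ≤ l j → 1 ≤ m j) ∧ N (fun j ↦ E j ^ m j) < 2 * ε := by
  obtain ⟨k, hk⟩ := hN.separable ε hε
  -- Uncountably many families and countably many balls: two reals share a ball, and the exponents
  -- of the quotient grow with l.
  choose i hi using fun r : ℝ ↦ hk fun j ↦ E j ^ ⌊r * l j⌋
  have : ¬ Function.Injective i := fun h ↦ not_countable h.countable
  obtain ⟨r, r', hrr, hne⟩ : ∃ r r', i r = i r' ∧ r ≠ r' := by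
    simpa [Function.Injective] using this
  wlog hlt : r < r' generalizing r r'
  · exact this r' r hrr.symm hne.symm (lt_of_le_of_ne (not_lt.1 hlt) hne.symm)
  obtain ⟨M, hM⟩ := exists_nat_gt (1 / (r' - r))
  have hpos : 0 < r' - r := by linarith
  refine ⟨fun j ↦ ⌊r' * l j⌋ - ⌊r * l j⌋, M, fun j hj ↦ ?_, ?_⟩
  · have h1 : (M : ℝ) ≤ l j := by exact_mod_cast hj
    have h2 : 1 < M * (r' - r) := by rwa [div_lt_iff₀ hpos] at hM
    have h3 : r * l j + 1 ≤ r' * l j := by nlinarith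
    have h4 := Int.floor_mono h3
    rw [Int.floor_add_one] at h4
    dsimp only
    omega
  · have h := hN.inv_mul_lt (hi r) (by rw [hrr]; exact hi r')
    convert h using 2
    ext j
    rw [Pi.mul_apply, Pi.inv_apply, ← zpow_neg, ← zpow_add]
    congr 1
    ring

end IsSeparableLength

/-! ### Short elements in powers of `RatAut` -/

namespace RatAut

/-- The homomorphism that lets products of two-level families act through nested blocks. -/
def nestedHom {I : Type} (B : I → BlockSystem ℤ) (B' : BlockSystem ℕ) :
    (I × ℤ × ℕ → RatAut) →* (I → RatAut) where
  toFun u i := (B i).hom fun j ↦ B'.hom fun l ↦ u (i, j, l)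
  map_one' := by
    ext1 i
    have h : (fun l : ℕ ↦ (1 : I × ℤ × ℕ → RatAut) (i, (0 : ℤ), l)) = 1 := rfl
    have h' : (fun j : ℤ ↦ B'.hom fun l ↦ (1 : I × ℤ × ℕ → RatAut) (i, j, l)) = 1 := by
      ext1 j
      exact B'.hom.map_one
    rw [h', (B i).hom.map_one]; rfl
  map_mul' u v := by
    ext1 i
    rw [Pi.mul_apply, ← (B i).hom.map_mul]
    congr 1
    ext1 j
    rw [Pi.mul_apply, ← B'.hom.map_mul]
    rfl

/-- The homomorphism that lets families act through blocks, coordinatewise. -/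
def blockHom {I : Type} (B : I → BlockSystem ℤ) : (I × ℤ → RatAut) →* (I → RatAut) where
  toFun u i := (B i).hom fun j ↦ u (i, j)
  map_one' := by
    ext1 i
    exact (B i).hom.map_one
  map_mul' u v := by
    ext1 i
    rw [Pi.mul_apply, ← (B i).hom.map_mul]
    rfl

theorem eq_one_of_support_empty {a : RatAut} {s t : ℚ} (hst : t < s)
    (h : ∀ y ∉ Set.Icc s t, a y = y) : a = 1 := by
  ext y
  exact h y fun hy ↦ absurd (hy.1.trans hy.2) (not_le.2 hst)

variable {I : Type} {N : (I → RatAut) → ℝ} {ε : ℝ}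

/-- On one inner index n every family agrees with a short f, and some family h of translation powers
supported there is short. By the swindle, u is the commutator of f and h, of length at most 2N(f) +
2N(h); off the fibre h is trivial, so the values of f there do not matter. The bound M excludes the
coordinates whose exponent may fail to be positive. -/
theorem exists_nested_lt (hN : IsSeparableLength N) (hε : 0 < ε) (B : I → BlockSystem ℤ)
    (B' : BlockSystem ℕ) :
    ∃ n M : ℕ, ∀ u : I × ℤ × ℕ → RatAut,
      (∀ i j l, ¬ (l = n ∧ M ≤ j.natAbs) → u (i, j, l) = 1) →
      (∀ i j l, ∀ y ∉ Set.Icc (0 : ℚ) (1 / 2), u (i, j, l) y = y) →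
      N (nestedHom B B' u) < 8 * ε := by
  have hN' := hN.comp (nestedHom B B')
  obtain ⟨n, hn⟩ := hN'.exists_eq_on_fibre (fun j : I × ℤ × ℕ ↦ j.2.2) hε
  obtain ⟨m, M, hm, hmN⟩ := hN'.exists_zpow_lt (fun j : I × ℤ × ℕ ↦ j.2.1.natAbs)
    (fun j ↦ if j.2.2 = n then shift else 1) hε
  refine ⟨n, M, fun u hu hu' ↦ ?_⟩
  have hv : ∀ j : I × ℤ × ℕ, ∃ v : RatAut,
      (j.2.2 = n → M ≤ j.2.1.natAbs → v * shift ^ m j * v⁻¹ * (shift ^ m j)⁻¹ = u j) ∧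
      (¬ M ≤ j.2.1.natAbs → v = 1) := by
    rintro j
    by_cases hj : M ≤ j.2.1.natAbs
    · obtain ⟨v, hv⟩ := exists_commutator (hu' j.1 j.2.1 j.2.2) (hm j hj)
      exact ⟨v, fun _ _ ↦ hv, fun h ↦ absurd hj h⟩
    · exact ⟨1, fun _ h ↦ absurd h hj, fun _ ↦ rfl⟩
  choose v hv hv1 using hv
  obtain ⟨f, hf, hfv⟩ := hn v
  set h : I × ℤ × ℕ → RatAut := fun j ↦ (if j.2.2 = n then shift else 1) ^ m j with hh
  have hu_eq : u = f * h * f⁻¹ * h⁻¹ := by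
    ext1 j
    simp only [Pi.mul_apply, Pi.inv_apply, hh]
    by_cases hj : j.2.2 = n
    · rw [hfv j hj, if_pos hj]
      by_cases hM : M ≤ j.2.1.natAbs
      · exact (hv j hj hM).symm
      · rw [hv1 j hM, hu j.1 j.2.1 j.2.2 fun h ↦ hM h.2]; group
    · rw [if_neg hj, hu j.1 j.2.1 j.2.2 fun h ↦ hj h.1]; group
  have h1 := hN'.map_mul_le (f * h * f⁻¹) h⁻¹
  have h2 := hN'.conj_le f h
  have h3 := hN'.map_inv h
  rw [← hu_eq] at h1
  linarith

/-- Elements supported on a suitable subinterval of almost all blocks are short. -/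
theorem exists_box_lt (hN : IsSeparableLength N) (hε : 0 < ε) (B : I → BlockSystem ℤ) :
    ∃ (p q : ℚ) (M : ℕ), p < q ∧ ∀ a : I × ℤ → RatAut,
      (∀ i j, ¬ M ≤ j.natAbs → a (i, j) = 1) →
      (∀ i j, ∀ y ∉ Set.Icc p q, a (i, j) y = y) → N (blockHom B a) < 8 * ε := by
  obtain ⟨B', -⟩ := exists_unit_blocks (fun k : ℕ ↦ (k : ℤ)) Nat.cast_injective
  obtain ⟨n, M, h⟩ := exists_nested_lt hN hε B B'
  refine ⟨B'.emb n 0, B'.emb n (1 / 2), M, B'.strictMono n (by norm_num), fun a ha ha' ↦ ?_⟩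
  have hlift : ∀ i j, ∃ u : ℕ → RatAut, B'.hom u = a (i, j) ∧
      (∀ l, ∀ y ∉ Set.Icc (0 : ℚ) (1 / 2), u l y = y) ∧
      (∀ l, ¬ (l = n ∧ M ≤ j.natAbs) → u l = 1) := by
    intro i j
    by_cases hM : M ≤ j.natAbs
    -- Inner indices other than n receive the empty interval [1, 1/2].
    · obtain ⟨u, hu, hu'⟩ := B'.lift (fun l ↦ if l = n then 0 else 1) (fun _ ↦ 1 / 2)
        (a (i, j)) fun x hx ↦ ha' i j x fun hxI ↦ by
          obtain ⟨y, rfl⟩ := B'.exists_emb_eq _ _ _ _ hxI.1 hxI.2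
          refine hx n y ?_ rfl
          rw [if_pos rfl]
          exact ⟨(B'.strictMono n).le_iff_le.1 hxI.1, (B'.strictMono n).le_iff_le.1 hxI.2⟩
      refine ⟨u, hu, fun l y hy ↦ hu' l y fun hy' ↦ hy ?_, fun l hl ↦ ?_⟩
      · split_ifs at hy' with h
        · exact hy'
        · exact absurd (hy'.1.trans hy'.2) (by norm_num)
      · have hln : l ≠ n := fun h ↦ hl ⟨h, hM⟩
        have := hu' l
        rw [if_neg hln] at this
        exact eq_one_of_support_empty (by norm_num) this
    · exact ⟨1, by rw [ha i j hM, map_one], fun _ _ _ ↦ rfl, fun _ _ ↦ rfl⟩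
  choose u hu hu' hu1 using hlift
  have := h (fun z ↦ u z.1 z.2.1 z.2.2) (fun i j l hl ↦ hu1 i j l hl)
    (fun i j l y hy ↦ hu' i j l y hy)
  convert this using 2
  ext1 i
  change (B i).hom _ = (B i).hom _
  congr 1
  ext1 j
  exact (hu i j).symm

/-- Conjugating by a short family of expansion powers squeezes the supports into the common box
[p,q] of `exists_box_lt`: 8ε for the box and 2 · 2ε for the conjugation. -/
theorem tail_lt (hN : IsSeparableLength N) (hε : 0 < ε) (B : I → BlockSystem ℤ)
    (a : I × ℤ → RatAut) (s t : I × ℤ → ℚ)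
    (ha : ∀ z, ∀ y ∉ Set.Icc (s z) (t z), a z y = y) :
    ∃ M : ℕ, N (blockHom B fun z ↦ if M ≤ z.2.natAbs then a z else 1) < 12 * ε := by
  obtain ⟨p, q, M, hpq, h⟩ := exists_box_lt hN hε B
  choose E hE using fun z : I × ℤ ↦ exists_expansion (s := s z) (t := t z) hpq
  have hN' := hN.comp (blockHom B)
  obtain ⟨m, M', hm, hmN⟩ := hN'.exists_zpow_lt (fun z : I × ℤ ↦ z.2.natAbs) E hε
  set e : I × ℤ → RatAut := fun z ↦ E z ^ m z with he
  refine ⟨max M M', ?_⟩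
  set a' : I × ℤ → RatAut := fun z ↦ if max M M' ≤ z.2.natAbs then a z else 1 with ha'
  have h1 := h (e⁻¹ * a' * e) (fun i j hj ↦ by
      simp only [Pi.mul_apply, Pi.inv_apply, ha']
      rw [if_neg fun h ↦ hj ((le_max_left _ _).trans h)]
      group)
    (fun i j y hy ↦ by
      simp only [Pi.mul_apply, Pi.inv_apply, ha', RelIso.mul_apply]
      split_ifs with hj
      · rw [ha (i, j), RelIso.inv_apply_self]
        exact fun h ↦ hy (hE (i, j) _ (hm (i, j) ((le_max_right _ _).trans hj)) y h)
      · rw [RelIso.one_apply, RelIso.inv_apply_self])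
  have h2 := hN'.conj_le e (e⁻¹ * a' * e)
  rw [show e * (e⁻¹ * a' * e) * e⁻¹ = a' by group] at h2
  linarith

/-- A length function has `ε`-short elements with prescribed values at two points. -/
def HasDenseBall (N : (I → RatAut) → ℝ) (ε : ℝ) : Prop :=
  ∀ p q p' q' : I → ℚ, (∀ i, p i < q i) → (∀ i, p' i < q' i) →
    ∃ w, N w < ε ∧ ∀ i, w i (p i) = p' i ∧ w i (q i) = q' i

/-- The dense ball supplies a conjugator shorter than ε that carries each support into the box of
block M, an index that `exists_box_lt` covers: 8ε + 2ε. -/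
theorem bounded_lt (hN : IsSeparableLength N) (hε : 0 < ε) (hd : HasDenseBall N ε)
    {g : I → RatAut} {p q : I → ℚ} (hpq : ∀ i, p i < q i)
    (hg : ∀ i, ∀ y ∉ Set.Icc (p i) (q i), g i y = y) : N g < 10 * ε := by
  obtain ⟨B, -⟩ := exists_unit_blocks (fun k : ℤ ↦ k) Function.injective_id
  obtain ⟨r, s, M, hrs, h⟩ := exists_box_lt hN hε fun _ : I ↦ B
  obtain ⟨w, hw, hw'⟩ := hd p q (fun _ ↦ B.emb M r) (fun _ ↦ B.emb M s) hpq
    fun _ ↦ B.strictMono _ hrs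
  have hlift : ∀ i, ∃ a : ℤ → RatAut, B.hom a = w i * g i * (w i)⁻¹ ∧
      (∀ j, ∀ y ∉ Set.Icc r s, a j y = y) ∧ ∀ j : ℤ, j ≠ M → a j = 1 := by
    intro i
    obtain ⟨a, ha, ha'⟩ := B.lift (fun j : ℤ ↦ if j = M then r else s + 1) (fun _ ↦ s)
      (w i * g i * (w i)⁻¹) fun x hx ↦ by
        rw [RelIso.mul_apply, RelIso.mul_apply, hg i, RelIso.apply_inv_self]
        intro hxI
        have h1 : B.emb M r ≤ x := by
          have := (w i).monotone hxI.1
          rwa [RelIso.apply_inv_self, (hw' i).1] at this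
        have h2 : x ≤ B.emb M s := by
          have := (w i).monotone hxI.2
          rwa [RelIso.apply_inv_self, (hw' i).2] at this
        obtain ⟨y, rfl⟩ := B.exists_emb_eq _ _ _ _ h1 h2
        refine hx M y ?_ rfl
        rw [if_pos rfl]
        exact ⟨(B.strictMono M).le_iff_le.1 h1, (B.strictMono M).le_iff_le.1 h2⟩
    refine ⟨a, ha, fun j y hy ↦ ha' j y fun hy' ↦ hy ?_, fun j hj ↦ ?_⟩
    · split_ifs at hy' with h
      · exact hy'
      · exact absurd (hy'.1.trans hy'.2) (by simp)
    · have := ha' j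
      rw [if_neg hj] at this
      exact eq_one_of_support_empty (by simp) this
  choose a ha ha' ha1 using hlift
  have h1 := h (fun z ↦ a z.1 z.2) (fun i j hj ↦ ha1 i j fun h ↦ hj (by simp [h]))
    fun i j y hy ↦ ha' i j y hy
  have h2 : blockHom (fun _ : I ↦ B) (fun z ↦ a z.1 z.2) = w * g * w⁻¹ := by
    ext1 i
    exact ha i
  rw [h2] at h1
  have h3 := hN.conj_le w⁻¹ (w * g * w⁻¹)
  rw [show w⁻¹ * (w * g * w⁻¹) * w⁻¹⁻¹ = g by group, hN.map_inv] at h3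
  linarith

/-- All but finitely many blocks form a tail (12ε), and the remaining ones have bounded support
(10ε). -/
theorem fixesDiscreteNhds_lt (hN : IsSeparableLength N) (hε : 0 < ε)
    (hd : HasDenseBall N ε) {g : I → RatAut} (hg : ∀ i, FixesDiscreteNhds (g i)) :
    N g < 22 * ε := by
  choose B a s t ha hst using fun i ↦ (hg i).exists_blockSystem
  obtain ⟨M, hM⟩ := tail_lt hN hε B (fun z ↦ a z.1 z.2) (fun z ↦ s z.1 z.2) (fun z ↦ t z.1 z.2)
    fun z y hy ↦ hst z.1 z.2 y hy
  let b : I × ℤ → RatAut := fun z ↦ if M ≤ z.2.natAbs then 1 else a z.1 z.2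
  have hgb : g = blockHom B (fun z ↦ if M ≤ z.2.natAbs then a z.1 z.2 else 1) * blockHom B b := by
    rw [← map_mul]
    ext1 i
    refine (ha i).symm.trans ?_
    change (B i).hom _ = (B i).hom _
    congr 1
    ext1 j
    simp only [Pi.mul_apply, b]
    split_ifs <;> simp
  have hbd : ∀ i, ∃ p q : ℚ, p < q ∧ ∀ y ∉ Set.Icc p q, blockHom B b i y = y := by
    intro i
    have hfin : {j : ℤ | ¬ M ≤ j.natAbs}.Finite :=
      (Set.finite_Icc (-(M : ℤ)) M).subset fun j hj ↦ by
        simp only [Set.mem_ofPred_eq, Set.mem_Icc] at hj ⊢; omega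
    obtain ⟨p, hp⟩ := (hfin.image fun j ↦ (B i).emb j (s i j)).bddBelow
    obtain ⟨q, hq⟩ := (hfin.image fun j ↦ (B i).emb j (t i j)).bddAbove
    refine ⟨min p q - 1, max p q + 1, ?_, fun y hy ↦ ?_⟩
    · have := min_le_left p q
      have := le_max_left p q
      linarith
    by_cases hy' : ∃ j r, y = (B i).emb j r
    · obtain ⟨j, r, rfl⟩ := hy'
      refine ((B i).hom_emb _ j r).trans (congrArg _ ?_)
      by_cases hj : M ≤ j.natAbs
      · simp only [b, if_pos hj, RelIso.one_apply]
      · simp only [b, if_neg hj]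
        refine hst i j r fun hr ↦ hy ?_
        have h1 := hp (Set.mem_image_of_mem _ hj)
        have h2 := hq (Set.mem_image_of_mem _ hj)
        have h3 := ((B i).strictMono j).monotone hr.1
        have h4 := ((B i).strictMono j).monotone hr.2
        have h5 := min_le_left p q
        have h6 := le_max_right p q
        constructor <;> linarith
    · push Not at hy'
      exact (B i).hom_of_forall_ne _ y hy'
  choose p q hpq hb using hbd
  have h1 := bounded_lt hN hε hd hpq hb
  have h2 := hN.map_mul_le (blockHom B (fun z ↦ if M ≤ z.2.natAbs then a z.1 z.2 else 1))
    (blockHom B b)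
  rw [← hgb] at h2
  linarith

theorem lt_of_hasDenseBall (hN : IsSeparableLength N) (hε : 0 < ε)
    (hd : HasDenseBall N ε) (g : I → RatAut) : N g < 44 * ε := by
  choose g₁ g₂ hg h1 h2 using fun i ↦ exists_mul_eq (g i)
  have := hN.map_mul_le g₁ g₂
  rw [← show g = g₁ * g₂ from funext hg] at this
  have := fixesDiscreteNhds_lt hN hε hd h1
  have := fixesDiscreteNhds_lt hN hε hd h2
  linarith

end RatAut

/-! ### Automatic continuity for `RatAut` -/

namespace RatAut

variable {N : RatAut → ℝ} {ε : ℝ}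

/-- Baire category: if the ball were dense in no such stabilizer, avoiding each of the countably
many balls that cover the group would be a cofinal condition, and a generic automorphism would avoid
them all. -/
theorem exists_finset_dense (hN : IsSeparableLength N) (hε : 0 < ε) :
    ∃ A : Finset ℚ, ∀ g : RatAut, (∀ x ∈ A, g x = x) → ∀ D : Finset ℚ,
      ∃ w, N w < ε ∧ ∀ x ∈ D, w x = g x := by
  classical
  by_contra! hcon
  obtain ⟨k, hk⟩ := hN.separable (ε / 2) (by positivity)
  let D : ℕ → Order.Cofinal (Order.PartialIso ℚ ℚ) := fun n ↦
    { carrier := {p | ∀ g : RatAut, (∀ q ∈ p.val, g q.1 = q.2) → ¬ N ((k n)⁻¹ * g) < ε / 2}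
      isCofinal := by
        intro p
        by_contra! h
        have h : ∀ p', p ≤ p' →
            ∃ g : RatAut, (∀ q ∈ p'.val, g q.1 = q.2) ∧ N ((k n)⁻¹ * g) < ε / 2 := by
          intro p' hp'
          by_contra! h'
          exact h p' h' hp'
        obtain ⟨g₀, hg₀, hN₀⟩ := h p le_rfl
        -- If all extensions of p could be completed inside the n-th ball, then g₀ and some g₁
        -- agreeing with g₀g on E would both lie there. So g₀⁻¹g₁ would be a short element agreeing
        -- with g on E.
        obtain ⟨g, hgA, E, hE⟩ := hcon (p.val.image Prod.fst)
        obtain ⟨g₁, hg₁, hN₁⟩ := h (partialIsoOfStrictMonoOn (E ∪ p.val.image Prod.fst)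
          (g₀ * g : RatAut) ((g₀ * g).strictMono.strictMonoOn _)) (by
            intro q hq
            have hq1 : q.1 ∈ p.val.image Prod.fst := Finset.mem_image_of_mem _ hq
            refine Finset.mem_image.2 ⟨q.1, Finset.mem_union_right _ hq1, ?_⟩
            rw [RelIso.mul_apply, hgA _ hq1, hg₀ q hq])
        have hw := hN.inv_mul_lt hN₀ hN₁
        obtain ⟨x, hx, hne⟩ := hE (g₀⁻¹ * g₁) (by linarith)
        apply hne
        have := hg₁ (x, (g₀ * g) x) (Finset.mem_image_of_mem _ (Finset.mem_union_left _ hx))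
        dsimp only at this
        rw [RelIso.mul_apply, this, RelIso.mul_apply, RelIso.inv_apply_self] }
  obtain ⟨g, -, hg⟩ := exists_extension_meeting default D
  obtain ⟨n, hn⟩ := hk g
  obtain ⟨r, hr, hr'⟩ := hg n
  exact hr g hr' hn

/-- Separable length functions on the group of order automorphisms of the rationals are
continuous for the topology of pointwise convergence. -/
theorem exists_finset_lt (hN : IsSeparableLength N) (hε : 0 < ε) :
    ∃ A : Finset ℚ, ∀ g : RatAut, (∀ x ∈ A, g x = x) → N g < ε := by
  classical
  obtain ⟨A, hA⟩ := exists_finset_dense hN (show 0 < ε / 44 by positivity)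
  refine ⟨A, fun g hg ↦ ?_⟩
  obtain ⟨K, hK, B, hfix, hlift⟩ := exists_finset_blocks A
  have := Fintype.ofFinite K
  obtain ⟨a, rfl⟩ := hlift g hg
  have h := lt_of_hasDenseBall (hN.comp B.hom) (show 0 < ε / 44 by positivity) ?_ a
  · linarith
  · intro p q p' q' hpq hpq'
    choose h hp hq using fun i ↦ exists_map_pair (hpq i) (hpq' i)
    -- Including A among the points where w is prescribed makes w fix A, so it lifts to the product.
    obtain ⟨w, hw, hwD⟩ := hA (B.hom h) (hfix h)
      (A ∪ (Finset.univ.image (fun i ↦ B.emb i (p i)) ∪ Finset.univ.image fun i ↦ B.emb i (q i)))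
    obtain ⟨v, rfl⟩ := hlift w fun x hx ↦ by
      rw [hwD x (Finset.mem_union_left _ hx), hfix h x hx]
    refine ⟨v, hw, fun i ↦ ⟨(B.strictMono i).injective ?_, (B.strictMono i).injective ?_⟩⟩
    · rw [← B.hom_emb, hwD _ (Finset.mem_union_right _ (Finset.mem_union_left _
        (Finset.mem_image_of_mem _ (Finset.mem_univ i)))), B.hom_emb, hp]
    · rw [← B.hom_emb, hwD _ (Finset.mem_union_right _ (Finset.mem_union_right _
        (Finset.mem_image_of_mem _ (Finset.mem_univ i)))), B.hom_emb, hq]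

end RatAut

/-! ### Displacement of an action, and fixed points -/

section Displacement

variable {G X : Type*} [Group G] [MetricSpace X] [CompactSpace X] [Nonempty X] [MulAction G X]
  [ContinuousConstSMul G X]

/-- The homeomorphism given by a group element, as a continuous map. -/
def smulMap (X : Type*) [MetricSpace X] [MulAction G X] [ContinuousConstSMul G X] (g : G) :
    C(X, X) := ⟨fun x ↦ g • x, continuous_const_smul g⟩

/-- The largest distance by which a group element moves a point. -/
noncomputable def displacement (X : Type*) [MetricSpace X] [CompactSpace X] [MulAction G X]
    [ContinuousConstSMul G X] (g : G) : ℝ :=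
  dist (smulMap X g) (smulMap X (1 : G))

theorem displacement_le_iff {g : G} {C : ℝ} :
    displacement X g ≤ C ↔ ∀ x : X, dist (g • x) x ≤ C := by
  rw [displacement, ContinuousMap.dist_le_iff_of_nonempty]
  simp [smulMap]

theorem dist_smul_le_displacement (g : G) (x : X) : dist (g • x) x ≤ displacement X g :=
  displacement_le_iff.1 le_rfl x

theorem displacement_mul_inv_le (g h : G) :
    displacement X (g * h⁻¹) ≤ dist (smulMap X g) (smulMap X h) := by
  refine displacement_le_iff.2 fun x ↦ ?_
  have := ContinuousMap.dist_apply_le_dist (f := smulMap X g) (g := smulMap X h) (h⁻¹ • x)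
  simpa [smulMap, mul_smul] using this

/-- Separability is inherited from C(X,X). Uniform distance controls gh⁻¹ while the definition asks
for g⁻¹h, so the dense sequence is taken among inverses. -/
theorem isSeparableLength_displacement : IsSeparableLength (displacement X : G → ℝ) := by
  have hinv : ∀ g : G, displacement X g⁻¹ ≤ displacement X g := fun g ↦
    displacement_le_iff.2 fun x ↦ by
      have := dist_smul_le_displacement g (g⁻¹ • x)
      rwa [smul_inv_smul, dist_comm] at this
  refine ⟨dist_self _, fun g ↦ le_antisymm (hinv g) ?_, fun g h ↦ ?_, fun ε hε ↦ ?_⟩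
  · have := hinv g⁻¹
    rwa [inv_inv] at this
  · refine displacement_le_iff.2 fun x ↦ ?_
    have h1 := dist_smul_le_displacement g (h • x)
    have h2 := dist_smul_le_displacement h x
    rw [mul_smul]
    exact (dist_triangle _ (h • x) _).trans (add_le_add h1 h2)
  · have hne : Nonempty (Set.range (smulMap X : G → C(X, X))) := ⟨⟨_, 1, rfl⟩⟩
    obtain ⟨u, hu⟩ := TopologicalSpace.exists_dense_seq (Set.range (smulMap X : G → C(X, X)))
    choose k hk using fun n ↦ (u n).2
    refine ⟨fun n ↦ (k n)⁻¹, fun g ↦ ?_⟩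
    obtain ⟨n, hn⟩ := hu.exists_dist_lt ⟨smulMap X g⁻¹, g⁻¹, rfl⟩ hε
    refine ⟨n, ?_⟩
    rw [inv_inv]
    have h1 := displacement_mul_inv_le (X := X) (k n) g⁻¹
    rw [inv_inv, hk, dist_comm] at h1
    exact h1.trans_lt hn

end Displacement

/-- A form of Ramsey's theorem: a function from finite sets of rational numbers to a compact
metric space is almost constant on the `n`-element subsets of arbitrarily large finite sets. -/
theorem exists_finset_dist_lt {X : Type*} [MetricSpace X] [CompactSpace X] (c : Finset ℚ → X)
    (n m : ℕ) {ε : ℝ} (hε : 0 < ε) :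
    ∃ (y : X) (T : Finset ℚ), T.card = m ∧ ∀ s ⊆ T, s.card = n → dist (c s) y < ε := by
  classical
  let 𝒰 : Ultrafilter ℚ := Filter.hyperfilter ℚ
  have hlim : ∀ f : ℚ → X, ∃ y, Filter.Tendsto f 𝒰 (nhds y) := fun f ↦ by
    obtain ⟨y, -, hy⟩ := isCompact_univ.ultrafilter_le_nhds (𝒰.map f) (by simp)
    exact ⟨y, hy⟩
  choose lim hlim using hlim
  let L : (Finset ℚ → X) → Finset ℚ → X := fun c s ↦ lim fun t ↦ c (insert t s)
  -- `d i s` is the iterated ultralimit of c over i points added to s. T is built greedily so that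
  -- every s ⊆ T with i points missing keeps `d i s` near `d n ∅`; nonprincipality makes each new
  -- point fresh.
  let d : ℕ → Finset ℚ → X := fun i ↦ L^[i] c
  have hd : ∀ i s, Filter.Tendsto (fun t ↦ d i (insert t s)) 𝒰 (nhds (d (i + 1) s)) := by
    intro i s
    have : d (i + 1) = L (d i) := Function.iterate_succ_apply' L i c
    rw [this]
    exact hlim _
  refine ⟨d n ∅, ?_⟩
  suffices h : ∃ T : Finset ℚ, T.card = m ∧ ∀ s ⊆ T, ∀ i, s.card + i = n →
      dist (d i s) (d n ∅) < ε by
    obtain ⟨T, hT, h⟩ := h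
    exact ⟨T, hT, fun s hs hsn ↦ h s hs 0 (by simpa using hsn)⟩
  induction m with
  | zero =>
    refine ⟨∅, rfl, fun s hs i hi ↦ ?_⟩
    obtain rfl := Finset.subset_empty.1 hs
    obtain rfl : i = n := by simpa using hi
    simpa using hε
  | succ m ih =>
    obtain ⟨T, hT, h⟩ := ih
    have h1 : ∀ᶠ t in (𝒰 : Filter ℚ), ∀ s ∈ T.powerset, ∀ i, s.card + (i + 1) = n →
        dist (d i (insert t s)) (d n ∅) < ε := by
      refine (Filter.eventually_all_finset _).2 fun s hs ↦ ?_
      by_cases hsn : s.card + 1 ≤ n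
      · have h2 := h s (Finset.mem_powerset.1 hs) (n - s.card) (by omega)
        have e : n - s.card = (n - s.card - 1) + 1 := by omega
        rw [e] at h2
        filter_upwards [((hd _ s).dist tendsto_const_nhds).eventually_lt_const h2] with t ht i hi
        obtain rfl : i = n - s.card - 1 := by omega
        exact ht
      · exact Filter.Eventually.of_forall fun t i hi ↦ by omega
    have h2 : ∀ᶠ t in (𝒰 : Filter ℚ), t ∉ T :=
      Filter.compl_mem_hyperfilter_of_finite T.finite_toSet
    obtain ⟨t, ht, htT⟩ := (h1.and h2).exists
    refine ⟨insert t T, by rw [Finset.card_insert_of_notMem htT, hT], fun s hs i hi ↦ ?_⟩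
    by_cases hts : t ∈ s
    · have := ht (s.erase t) (Finset.mem_powerset.2 (Finset.subset_insert_iff.1 hs)) i (by
        have := Finset.card_erase_add_one hts; omega)
      rwa [Finset.insert_erase hts] at this
    · exact h s ((Finset.subset_insert_iff_of_notMem hts).1 hs) i hi

/-- The order automorphism group of the rationals, as a discrete group, has a fixed point in every
action on a nonempty compact metric space. -/
theorem RatAut.exists_fixed {G X : Type*} [Group G] [MetricSpace X] [CompactSpace X] [Nonempty X]
    [MulAction G X] [ContinuousConstSMul G X] (ρ : RatAut →* G) :
    ∃ x : X, ∀ g, ρ g • x = x := by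
  classical
  have hN := (isSeparableLength_displacement (G := G) (X := X)).comp ρ
  have happrox : ∀ (F : Finset RatAut) (ε : ℝ), 0 < ε →
      ∃ x : X, ∀ h ∈ F, dist (ρ h • x) x ≤ 4 * ε := by
    intro F ε hε
    obtain ⟨A, hA⟩ := RatAut.exists_finset_lt hN hε
    obtain ⟨x₀⟩ := ‹Nonempty X›
    have hg : ∀ s : Finset ℚ, ∃ g : RatAut, s.card = A.card → s.image g = A := fun s ↦ by
      by_cases hs : s.card = A.card
      · obtain ⟨g, hg⟩ := RatAut.exists_image_eq hs
        exact ⟨g, fun _ ↦ hg⟩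
      · exact ⟨1, fun h ↦ absurd h hs⟩
    choose γ hγ using hg
    -- Up to ε, the point `ρ g • x₀` depends only on the set g⁻¹A. Moving B by k into the almost
    -- homogeneous set T makes all the sets attached to hk⁻¹ look alike, so F barely moves `ρ k⁻¹ •
    -- x₀`.
    let B : Finset ℚ := (insert 1 F).biUnion fun h ↦ A.image (h⁻¹ : RatAut)
    obtain ⟨y, T, hT, hy⟩ := exists_finset_dist_lt (fun s ↦ ρ (γ s) • x₀) A.card B.card hε
    obtain ⟨k, hk⟩ := RatAut.exists_image_eq hT.symm
    have key : ∀ h ∈ insert 1 F, dist (ρ (h * k⁻¹) • x₀) y < 2 * ε := by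
      intro h hh
      set s := A.image (k * h⁻¹ : RatAut) with hs
      have hsT : s ⊆ T := by
        rw [← hk, hs]
        intro x hx
        obtain ⟨a, ha, rfl⟩ := Finset.mem_image.1 hx
        exact Finset.mem_image_of_mem _ (Finset.mem_biUnion.2 ⟨h, hh, Finset.mem_image_of_mem _ ha⟩)
      have hcard : s.card = A.card := Finset.card_image_of_injective _ (k * h⁻¹).injective
      have h1 := hy s hsT hcard
      have h2 : ∀ x ∈ A, (h * k⁻¹ * (γ s)⁻¹) x = x := by
        have e : A.image (γ s * (k * h⁻¹) : RatAut) = A := by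
          conv_rhs => rw [← hγ s hcard, hs, Finset.image_image]
          rfl
        intro x hx
        have := RatAut.apply_eq_self_of_image_eq e x hx
        conv_lhs => rw [← this]
        rw [← RelIso.mul_apply, show h * k⁻¹ * (γ s)⁻¹ * (γ s * (k * h⁻¹)) = 1 by group]
        rfl
      have h3 := dist_smul_le_displacement (ρ (h * k⁻¹ * (γ s)⁻¹)) (ρ (γ s) • x₀)
      rw [← mul_smul, ← map_mul, inv_mul_cancel_right] at h3
      have h4 := hA _ h2
      have h5 := dist_triangle (ρ (h * k⁻¹) • x₀) (ρ (γ s) • x₀) y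
      linarith
    refine ⟨ρ k⁻¹ • x₀, fun h hh ↦ ?_⟩
    have h1 := key h (Finset.mem_insert_of_mem hh)
    have h2 := key 1 (Finset.mem_insert_self _ _)
    rw [one_mul] at h2
    rw [← mul_smul, ← map_mul]
    have := dist_triangle_right (ρ (h * k⁻¹) • x₀) (ρ k⁻¹ • x₀) y
    linarith
  have hclosed : ∀ z : RatAut × ℕ,
      IsClosed {x : X | dist (ρ z.1 • x) x ≤ 1 / ((z.2 : ℝ) + 1)} := fun z ↦
    isClosed_le ((continuous_const_smul _).dist continuous_id) continuous_const
  have hne : (⋂ z : RatAut × ℕ, {x : X | dist (ρ z.1 • x) x ≤ 1 / ((z.2 : ℝ) + 1)}).Nonempty := by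
    refine CompactSpace.iInter_nonempty hclosed fun S ↦ ?_
    have hM : ∀ z ∈ S, z.2 ≤ S.sup Prod.snd := fun z hz ↦ Finset.le_sup (f := Prod.snd) hz
    set M := S.sup Prod.snd
    obtain ⟨x, hx⟩ := happrox (S.image Prod.fst) (1 / ((M : ℝ) + 1) / 4) (by positivity)
    refine ⟨x, Set.mem_iInter₂.2 fun z hz ↦ ?_⟩
    have h1 := hx z.1 (Finset.mem_image_of_mem _ hz)
    have h2 : (z.2 : ℝ) ≤ M := by exact_mod_cast hM z hz
    refine h1.trans (le_trans (le_of_eq (by ring)) (one_div_le_one_div_of_le (by positivity)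
      (by linarith : (z.2 : ℝ) + 1 ≤ M + 1)))
  obtain ⟨x, hx⟩ := hne
  refine ⟨x, fun g ↦ dist_le_zero.1 (le_of_forall_pos_le_add fun ε hε ↦ ?_)⟩
  obtain ⟨n, hn⟩ := exists_nat_one_div_lt hε
  have := Set.mem_iInter.1 hx (g, n)
  rw [Set.mem_ofPred_eq] at this
  dsimp only at this
  linarith

/-! ### Circular orders -/

namespace IsCircularOrder

variable {C : Type*} {R : C → C → C → Prop}

theorem cyclic' (hR : IsCircularOrder R) {a b c : C} (h : R a b c) : R c a b :=
  hR.cyclic _ _ _ (hR.cyclic _ _ _ h)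

theorem ne₁₂ (hR : IsCircularOrder R) {a b c : C} (h : R a b c) : a ≠ b := fun e ↦ by
  subst e; exact hR.asymm _ _ _ h h

theorem ne₂₃ (hR : IsCircularOrder R) {a b c : C} (h : R a b c) : b ≠ c :=
  hR.ne₁₂ (hR.cyclic _ _ _ h)

theorem ne₁₃ (hR : IsCircularOrder R) {a b c : C} (h : R a b c) : a ≠ c :=
  (hR.ne₁₂ (hR.cyclic' h)).symm

theorem not_swap (hR : IsCircularOrder R) {a b c : C} (h : R a b c) : ¬ R a c b := fun h' ↦
  hR.asymm _ _ _ h (hR.cyclic' h')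

theorem trans_right (hR : IsCircularOrder R) {a b c d : C} (h : R a b c) (h' : R a c d) :
    R b c d :=
  hR.cyclic' (hR.trans _ _ _ _ (hR.cyclic _ _ _ h') (hR.cyclic' h))

/-- The linear order on the complement of a point of a circularly ordered set. -/
@[reducible] noncomputable def linearOrder (hR : IsCircularOrder R) (o : C) :
    LinearOrder {x : C // x ≠ o} where
  le x y := x = y ∨ R o x y
  lt x y := R o x y
  le_refl x := Or.inl rfl
  le_trans x y z := by
    rintro (rfl | h) (rfl | h')
    · exact Or.inl rfl
    · exact Or.inr h'
    · exact Or.inr h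
    · exact Or.inr (hR.trans _ _ _ _ h h')
  le_antisymm x y := by
    rintro (h | h) (h' | h')
    · exact h
    · exact h
    · exact h'.symm
    · exact absurd h' (hR.not_swap h)
  lt_iff_le_not_ge x y := by
    constructor
    · refine fun h ↦ ⟨Or.inr h, ?_⟩
      rintro (rfl | h')
      · exact hR.ne₂₃ h rfl
      · exact hR.not_swap h h'
    · rintro ⟨rfl | h, h'⟩
      · exact absurd (Or.inl rfl) h'
      · exact h
  le_total x y := by
    by_cases h : x = y
    · exact Or.inl (Or.inl h)
    · rcases hR.total o x y x.2.symm (fun e ↦ h (Subtype.ext e)) y.2.symm with h | h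
      · exact Or.inl (Or.inr h)
      · exact Or.inr (Or.inr h)
  toDecidableLE := Classical.decRel _

end IsCircularOrder

/-! ### Charts and point stabilizers -/

/-- A circular order is dense if it has points between any two distinct points, in both
directions. -/
def IsDenseCircularOrder {C : Type*} (R : C → C → C → Prop) : Prop :=
  ∀ a b, a ≠ b → ∃ x, R a x b

/-- A coordinate on the complement of a point of a circularly ordered set. -/
structure CircleChart {C : Type*} (R : C → C → C → Prop) (o : C) where
  e : ℚ → C
  ne : ∀ t, e t ≠ o
  injective : Function.Injective e
  exists_eq : ∀ x, x ≠ o → ∃ t, e t = x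
  rel_iff : ∀ s t, R o (e s) (e t) ↔ s < t

/-- Removing a point leaves a countable dense linear order without endpoints, to which Cantor's
theorem applies. -/
theorem exists_circleChart {C : Type*} [Countable C] [Nontrivial C] {R : C → C → C → Prop}
    (hR : IsCircularOrder R) (hd : IsDenseCircularOrder R) (o : C) :
    Nonempty (CircleChart R o) := by
  let := hR.linearOrder o
  have hlt : ∀ x y : {x : C // x ≠ o}, x < y ↔ R o x y := fun _ _ ↦ Iff.rfl
  have : Nonempty {x : C // x ≠ o} := let ⟨x, hx⟩ := exists_ne o; ⟨⟨x, hx⟩⟩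
  have : NoMaxOrder {x : C // x ≠ o} := ⟨fun x ↦ by
    obtain ⟨y, hy⟩ := hd x o x.2
    exact ⟨⟨y, hR.ne₂₃ hy⟩, hR.cyclic' hy⟩⟩
  have : NoMinOrder {x : C // x ≠ o} := ⟨fun x ↦ by
    obtain ⟨y, hy⟩ := hd o x x.2.symm
    exact ⟨⟨y, (hR.ne₁₂ hy).symm⟩, hy⟩⟩
  have : DenselyOrdered {x : C // x ≠ o} := ⟨fun x y hxy ↦ by
    obtain ⟨z, hz⟩ := hd x y (hR.ne₂₃ hxy)
    have h1 : R y o z := hR.trans _ _ _ _ (hR.cyclic' hxy) (hR.cyclic' hz)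
    have h2 : R o x z := hR.trans_right (hR.cyclic' hxy) (hR.cyclic' hz)
    exact ⟨⟨z, (hR.ne₂₃ h1).symm⟩, h2, hR.cyclic _ _ _ h1⟩⟩
  obtain ⟨f⟩ := Order.iso_of_countable_dense ℚ {x : C // x ≠ o}
  exact ⟨⟨fun t ↦ f t, fun t ↦ (f t).2, Subtype.val_injective.comp f.injective,
    fun x hx ↦ ⟨f.symm ⟨x, hx⟩, by simp⟩, fun s t ↦ (hlt _ _).symm.trans f.lt_iff_lt⟩⟩

namespace CircleChart

variable {C : Type*} {R : C → C → C → Prop} {o : C}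

theorem rel_of_lt (hR : IsCircularOrder R) (χ : CircleChart R o) {s t u : ℚ} (h : s < t)
    (h' : t < u) : R (χ.e s) (χ.e t) (χ.e u) :=
  hR.trans_right ((χ.rel_iff _ _).2 h) ((χ.rel_iff _ _).2 h')

theorem rel_iff' (hR : IsCircularOrder R) (χ : CircleChart R o) (s t u : ℚ) :
    R (χ.e s) (χ.e t) (χ.e u) ↔ s < t ∧ t < u ∨ t < u ∧ u < s ∨ u < s ∧ s < t := by
  constructor
  · intro h
    have h1 : s ≠ t := fun e ↦ hR.ne₁₂ h (e ▸ rfl)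
    have h2 : t ≠ u := fun e ↦ hR.ne₂₃ h (e ▸ rfl)
    have h3 : s ≠ u := fun e ↦ hR.ne₁₃ h (e ▸ rfl)
    have k1 : ¬ (s < u ∧ u < t) := fun k ↦ hR.not_swap h (χ.rel_of_lt hR k.1 k.2)
    have k2 : ¬ (u < t ∧ t < s) := fun k ↦ hR.not_swap h (hR.cyclic' (χ.rel_of_lt hR k.1 k.2))
    have k3 : ¬ (t < s ∧ s < u) := fun k ↦
      hR.not_swap h (hR.cyclic _ _ _ (χ.rel_of_lt hR k.1 k.2))
    grind
  · rintro (h | h | h)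
    · exact χ.rel_of_lt hR h.1 h.2
    · exact hR.cyclic' (χ.rel_of_lt hR h.1 h.2)
    · exact hR.cyclic _ _ _ (χ.rel_of_lt hR h.1 h.2)

/-- The bijection between the rationals with a point added and the circle. -/
noncomputable def equiv (χ : CircleChart R o) : Option ℚ ≃ C :=
  Equiv.ofBijective (fun t ↦ t.elim o χ.e) (by
    constructor
    · rintro (_ | s) (_ | t) h
      · rfl
      · exact absurd h.symm (χ.ne t)
      · exact absurd h (χ.ne s)
      · exact congrArg some (χ.injective h)
    · intro x
      by_cases hx : x = o
      · exact ⟨none, hx.symm⟩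
      · obtain ⟨t, ht⟩ := χ.exists_eq x hx
        exact ⟨some t, ht⟩)

/-- The permutation of the circle given by an order automorphism in a chart. -/
noncomputable def perm (χ : CircleChart R o) (g : RatAut) : Equiv.Perm C :=
  χ.equiv.symm.trans ((Equiv.optionCongr g.toEquiv).trans χ.equiv)

theorem perm_base (χ : CircleChart R o) (g : RatAut) : χ.perm g o = o := by
  have h : χ.equiv none = o := rfl
  have h' : χ.equiv.symm o = none := by rw [Equiv.symm_apply_eq, h]
  simp [perm, h, h']

theorem perm_e (χ : CircleChart R o) (g : RatAut) (t : ℚ) : χ.perm g (χ.e t) = χ.e (g t) := by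
  have : ∀ t, χ.equiv (some t) = χ.e t := fun _ ↦ rfl
  rw [← this, ← this]
  simp [perm]

theorem cases (χ : CircleChart R o) (x : C) : x = o ∨ ∃ t, x = χ.e t := by
  by_cases hx : x = o
  · exact Or.inl hx
  · obtain ⟨t, ht⟩ := χ.exists_eq x hx
    exact Or.inr ⟨t, ht.symm⟩

theorem perm_mul (χ : CircleChart R o) (g h : RatAut) : χ.perm (g * h) = χ.perm g * χ.perm h := by
  ext x
  rcases χ.cases x with rfl | ⟨t, rfl⟩
  · simp [perm_base]
  · simp [perm_e]

theorem rel_perm (hR : IsCircularOrder R) (χ : CircleChart R o) (g : RatAut) {a b c : C}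
    (h : R a b c) : R (χ.perm g a) (χ.perm g b) (χ.perm g c) := by
  have key : ∀ {b c : C}, R o b c → R o (χ.perm g b) (χ.perm g c) := by
    intro b c h
    obtain ⟨s, rfl⟩ := χ.exists_eq b (hR.ne₁₂ h).symm
    obtain ⟨t, rfl⟩ := χ.exists_eq c (hR.ne₁₃ h).symm
    rw [χ.rel_iff] at h
    rw [perm_e, perm_e, χ.rel_iff]
    exact g.strictMono h
  rcases χ.cases a with rfl | ⟨s, rfl⟩
  · rw [perm_base]; exact key h
  rcases χ.cases b with rfl | ⟨t, rfl⟩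
  · rw [perm_base]; exact hR.cyclic' (key (hR.cyclic _ _ _ h))
  rcases χ.cases c with rfl | ⟨u, rfl⟩
  · rw [perm_base]; exact hR.cyclic _ _ _ (key (hR.cyclic' h))
  · rw [rel_iff' hR] at h
    simp only [perm_e]
    rw [rel_iff' hR]
    simpa only [g.lt_iff_lt] using h

/-- The homomorphism from order automorphisms to automorphisms of the circle given by a chart. -/
noncomputable def hom (hR : IsCircularOrder R) (χ : CircleChart R o) : RatAut →* ternaryAut R where
  toFun g := ⟨χ.perm g, fun a b c ↦ by
    refine ⟨fun h ↦ ?_, χ.rel_perm hR g⟩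
    have := χ.rel_perm hR g⁻¹ h
    simp only [← Equiv.Perm.mul_apply, ← perm_mul, inv_mul_cancel] at this
    have h1 : χ.perm 1 = 1 := by
      have := χ.perm_mul 1 1
      rwa [one_mul, left_eq_mul] at this
    simpa [h1] using this⟩
  map_one' := by
    have := χ.perm_mul 1 1
    rw [one_mul, left_eq_mul] at this
    exact Subtype.ext this
  map_mul' g h := Subtype.ext (χ.perm_mul g h)

theorem hom_base (hR : IsCircularOrder R) (χ : CircleChart R o) (g : RatAut) :
    χ.hom hR g • o = o := χ.perm_base g

theorem hom_e (hR : IsCircularOrder R) (χ : CircleChart R o) (g : RatAut) (t : ℚ) :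
    χ.hom hR g • χ.e t = χ.e (g t) := χ.perm_e g t

end CircleChart

theorem smul_rel_iff {C : Type*} {R : C → C → C → Prop} (g : ternaryAut R) (a b c : C) :
    R (g • a) (g • b) (g • c) ↔ R a b c := g.2 a b c

/-- With `hom_base`, this identifies the stabilizer of o with the image of `RatAut`. -/
theorem CircleChart.exists_hom_eq {C : Type*} {R : C → C → C → Prop} {o : C}
    (hR : IsCircularOrder R) (χ : CircleChart R o) (g : ternaryAut R) (hg : g • o = o) :
    ∃ g', χ.hom hR g' = g := by
  have hne : ∀ (h : ternaryAut R), h • o = o → ∀ t, ∃ s, χ.e s = h • χ.e t := fun h hh t ↦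
    χ.exists_eq _ fun h' ↦ χ.ne t (smul_left_cancel h (h'.trans hh.symm))
  choose f hf using hne g hg
  have hmono : StrictMono f := fun s t hst ↦ by
    have h := (smul_rel_iff g _ _ _).2 ((χ.rel_iff _ _).2 hst)
    rwa [hg, ← hf, ← hf, χ.rel_iff] at h
  have hsurj : Function.Surjective f := fun t ↦ by
    obtain ⟨s, hs⟩ := hne g⁻¹ (inv_smul_eq_iff.2 hg.symm) t
    exact ⟨s, χ.injective (by rw [hf, hs, smul_inv_smul])⟩
  refine ⟨hmono.orderIsoOfSurjective f hsurj, Subtype.ext (Equiv.ext fun x ↦ ?_)⟩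
  rcases χ.cases x with rfl | ⟨t, rfl⟩
  · exact (χ.hom_base hR _).trans hg.symm
  · exact (χ.hom_e hR _ t).trans (hf t)

/-! ### Equivariant maps from the circle -/

theorem RatAut.exists_map_triple {a b c a' b' c' : ℚ} (h₁ : a < b) (h₂ : b < c) (h₁' : a' < b')
    (h₂' : b' < c') : ∃ g : RatAut, g a = a' ∧ g b = b' ∧ g c = c' := by
  have h₃ := h₁.trans h₂
  have h₃' := h₁'.trans h₂'
  obtain ⟨g, hg⟩ := RatAut.exists_eq_on_finset {a, b, c}
    (fun x ↦ if x = a then a' else if x = b then b' else c') (by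
      intro x hx y hy hxy
      simp only [Finset.coe_insert, Finset.coe_singleton, Set.mem_insert_iff,
        Set.mem_singleton_iff] at hx hy
      rcases hx with rfl | rfl | rfl <;> rcases hy with rfl | rfl | rfl <;>
        first
        | exact absurd hxy (lt_irrefl _)
        | exact absurd hxy (not_lt.2 (by linarith))
        | simpa [h₁.ne', h₂.ne', h₃.ne'] using by assumption)
  exact ⟨g, by simpa using hg a (by simp), by simpa [h₁.ne'] using hg b (by simp),
    by simpa [h₂.ne', h₃.ne'] using hg c (by simp)⟩

theorem RatAut.exists_glue (g : RatAut) {c : ℚ} (h : g c = c) :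
    ∃ f : RatAut, (∀ x ≤ c, f x = x) ∧ ∀ x, c ≤ x → f x = g x := by
  have hmono : StrictMono fun x ↦ if x ≤ c then x else g x := by
    intro x y hxy
    dsimp only
    split_ifs with h1 h2 h2
    · exact hxy
    · have := g.strictMono (not_le.1 h2); linarith
    · linarith
    · exact g.strictMono hxy
  refine ⟨hmono.orderIsoOfSurjective _ fun y ↦ ?_, fun x hx ↦ ?_, fun x hx ↦ ?_⟩
  · by_cases hy : y ≤ c
    · exact ⟨y, if_pos hy⟩
    · refine ⟨g.symm y, ?_⟩
      have : ¬ g.symm y ≤ c := fun h' ↦ hy (by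
        have := g.monotone h'; rwa [g.apply_symm_apply, h] at this)
      simp only [if_neg this, g.apply_symm_apply]
  · exact if_pos hx
  · rcases hx.eq_or_lt with rfl | hx
    · exact (if_pos le_rfl).trans h.symm
    · exact if_neg (not_le.2 hx)

/-- Points of the arc from `a` to `b` that also lie in the arc from `p` to `b`. -/
theorem exists_rel_and_rel {C : Type*} {R : C → C → C → Prop} (hR : IsCircularOrder R) (hd : IsDenseCircularOrder R)
    {a p b : C} (ha : a ≠ b) (hp : p ≠ b) : ∃ w, R a w b ∧ R p w b := by
  by_cases hap : a = p
  · obtain ⟨w, hw⟩ := hd a b ha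
    exact ⟨w, hw, hap ▸ hw⟩
  rcases hR.total a p b hap hp ha with h | h
  · obtain ⟨w, hw⟩ := hd p b hp
    exact ⟨w, hR.cyclic _ _ _ (hR.trans _ _ _ _ (hR.cyclic' h) (hR.cyclic' hw)), hw⟩
  · obtain ⟨w, hw⟩ := hd a b ha
    exact ⟨w, hw, hR.cyclic _ _ _ (hR.trans _ _ _ _ (hR.cyclic _ _ _ h) (hR.cyclic' hw))⟩

section Dynamics

variable {C : Type*} [Countable C] [Nontrivial C] {R : C → C → C → Prop}

theorem exists_smul_eq_and_smul_eq (hR : IsCircularOrder R) (hd : IsDenseCircularOrder R)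
    {u v w : C} (hv : v ≠ u) (hw : w ≠ u) : ∃ g : ternaryAut R, g • u = u ∧ g • v = w := by
  obtain ⟨χ⟩ := exists_circleChart hR hd u
  obtain ⟨s, rfl⟩ := χ.exists_eq v hv
  obtain ⟨t, rfl⟩ := χ.exists_eq w hw
  refine ⟨χ.hom hR (OrderIso.addRight (t - s)), χ.hom_base hR _, ?_⟩
  rw [χ.hom_e, OrderIso.addRight_apply, add_sub_cancel]

theorem exists_smul_eq_of_circularOrder (hR : IsCircularOrder R) (hd : IsDenseCircularOrder R)
    (u v : C) : ∃ g : ternaryAut R, g • u = v := by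
  by_cases h : u = v
  · exact ⟨1, by rw [one_smul, h]⟩
  · obtain ⟨x, hx⟩ := hd u v h
    obtain ⟨g, -, hg⟩ := exists_smul_eq_and_smul_eq hR hd (hR.ne₁₂ hx) (hR.ne₂₃ hx).symm
    exact ⟨g, hg⟩

/-- The stabilizer of u is transitive on the other points, so one coincidence ψ u = ψ v spreads to
all of them. -/
theorem injective_or_constant (hR : IsCircularOrder R) (hd : IsDenseCircularOrder R)
    {X : Type*} [MulAction (ternaryAut R) X] {ψ : C → X} (hψ : ∀ (g : ternaryAut R) q, ψ (g • q) = g • ψ q) :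
    Function.Injective ψ ∨ ∀ u v, ψ u = ψ v := by
  by_cases h : Function.Injective ψ
  · exact Or.inl h
  right
  obtain ⟨u, v, huv, hne⟩ : ∃ u v, ψ u = ψ v ∧ u ≠ v := by simpa [Function.Injective] using h
  have key : ∀ w, ψ w = ψ u := by
    intro w
    by_cases hw : w = u
    · rw [hw]
    · obtain ⟨g, hg, hg'⟩ := exists_smul_eq_and_smul_eq hR hd hne.symm hw
      rw [← hg', hψ, ← huv, ← hψ, hg]
  exact fun a b ↦ (key a).trans (key b).symm

variable {X : Type*} [MulAction (ternaryAut R) X]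

/-- The circle is the coset space of the stabilizer of o, so the orbit map of x factors through it.
-/
theorem exists_equivariant (hR : IsCircularOrder R) (hd : IsDenseCircularOrder R) (o : C) {x : X}
    (hx : ∀ g : ternaryAut R, g • o = o → g • x = x) :
    ∃ φ : C → X, φ o = x ∧ ∀ (g : ternaryAut R) q, φ (g • q) = g • φ q := by
  choose γ hγ using exists_smul_eq_of_circularOrder hR hd o
  have key : ∀ g h : ternaryAut R, g • o = h • o → g • x = h • x := by
    intro g h hgh
    have := hx (h⁻¹ * g) (by rw [mul_smul, hgh, inv_smul_smul])
    rw [mul_smul, inv_smul_eq_iff] at this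
    exact this
  refine ⟨fun q ↦ γ q • x, ?_, fun g q ↦ ?_⟩
  · exact (key (γ o) 1 (by rw [hγ, one_smul])).trans (one_smul _ x)
  · rw [← mul_smul]
    exact key _ _ (by rw [hγ, mul_smul, hγ])

variable [MetricSpace X] [ContinuousConstSMul (ternaryAut R) X]

/-- A map on the circle is left continuous. -/
def IsLeftContinuous {C X : Type*} [MetricSpace X] (R : C → C → C → Prop) (ψ : C → X) : Prop :=
  ∀ q, ∀ ε > 0, ∃ p, p ≠ q ∧ ∀ x, R p x q → dist (ψ x) (ψ q) < ε

/-- The half-open arc `(p, q]`. -/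
def arcIoc {C : Type*} (R : C → C → C → Prop) (p q : C) : Set C := {x | R p x q ∨ x = q}

/-- For any z strictly between q' and p' there are automorphisms fixing (p',q'] pointwise and
pushing (p,q] into a given left neighbourhood of z. A common point y of the closures would be fixed
by them yet sent close to ψ z, so y = ψ z for all such z, against injectivity. -/
theorem disjoint_closure_image_arcIoc (hR : IsCircularOrder R) (hd : IsDenseCircularOrder R)
    {ψ : C → X} (hψ : ∀ (g : ternaryAut R) q, ψ (g • q) = g • ψ q) (hl : IsLeftContinuous R ψ)
    (hinj : Function.Injective ψ) {p q p' q' : C} (h1 : R p' q' p) (h2 : R p' p q) :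
    Disjoint (closure (ψ '' arcIoc R p q)) (closure (ψ '' arcIoc R p' q')) := by
  rw [Set.disjoint_left]
  intro y hy hy'
  obtain ⟨χ⟩ := exists_circleChart hR hd p'
  obtain ⟨b, rfl⟩ := χ.exists_eq q' (hR.ne₁₂ h1).symm
  obtain ⟨p, rfl⟩ := χ.exists_eq p (hR.ne₁₂ h2).symm
  obtain ⟨q, rfl⟩ := χ.exists_eq q (hR.ne₁₃ h2).symm
  rw [χ.rel_iff] at h1 h2
  have key : ∀ z, b < z → y = ψ (χ.e z) := by
    intro z hz
    refine dist_le_zero.1 (le_of_forall_pos_le_add fun ε hε ↦ ?_)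
    obtain ⟨p₁, hp₁, hp₁x⟩ := hl (χ.e z) ε hε
    obtain ⟨w, hw, hw'⟩ := exists_rel_and_rel hR hd
      (show χ.e b ≠ χ.e z from fun h ↦ hz.ne (χ.injective h)) hp₁
    obtain ⟨z₀, rfl⟩ := χ.exists_eq w fun h ↦ by
      rw [h] at hw
      exact absurd ((χ.rel_iff _ _).1 (hR.cyclic _ _ _ hw)) hz.not_gt
    have hz₀ : b < z₀ ∧ z₀ < z := by
      rw [χ.rel_iff' hR] at hw
      rcases hw with h | h | h
      · exact h
      · linarith
      · linarith
    obtain ⟨z₁, hz₁, hz₁'⟩ := exists_between hz₀.2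
    obtain ⟨z₂, hz₂, hz₂'⟩ := exists_between hz₁'
    obtain ⟨g₀, hg₀b, hg₀p, hg₀q⟩ := RatAut.exists_map_triple h1 h2 (hz₀.1.trans hz₁) hz₂
    obtain ⟨g, hg, hg'⟩ := RatAut.exists_glue g₀ hg₀b
    have hfix : χ.hom hR g • y = y := by
      have hcl : IsClosed {x : X | χ.hom hR g • x = x} :=
        isClosed_eq (continuous_const_smul _) continuous_id
      refine closure_minimal ?_ hcl hy'
      rintro _ ⟨x, hx, rfl⟩
      rw [Set.mem_ofPred_eq, ← hψ]
      congr 1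
      rcases hx with hx | rfl
      · obtain ⟨t, rfl⟩ := χ.exists_eq x (hR.ne₁₂ hx).symm
        rw [χ.rel_iff] at hx
        rw [χ.hom_e, hg t hx.le]
      · rw [χ.hom_e, hg b le_rfl]
    have hball : dist (χ.hom hR g • y) (ψ (χ.e z)) ≤ ε := by
      have hcl : IsClosed {x : X | dist (χ.hom hR g • x) (ψ (χ.e z)) ≤ ε} :=
        isClosed_le ((continuous_const_smul _).dist continuous_const) continuous_const
      refine closure_minimal ?_ hcl hy
      rintro _ ⟨x, hx, rfl⟩
      rw [Set.mem_ofPred_eq, ← hψ]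
      have hx : ∃ t, χ.e t = x ∧ p < t ∧ t ≤ q := by
        rcases hx with hx | rfl
        · obtain ⟨t, rfl⟩ := χ.exists_eq x fun h ↦ by
            rw [h] at hx
            exact absurd ((χ.rel_iff _ _).1 (hR.cyclic _ _ _ hx)) h2.not_gt
          rw [χ.rel_iff' hR] at hx
          refine ⟨t, rfl, ?_⟩
          rcases hx with h | h | h
          · exact ⟨h.1, h.2.le⟩
          · linarith
          · linarith
        · exact ⟨q, rfl, h2, le_rfl⟩
      obtain ⟨t, rfl, hpt, htq⟩ := hx
      rw [χ.hom_e, hg' t (by linarith)]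
      refine (hp₁x _ ?_).le
      have k1 : z₁ < g₀ t := by rw [← hg₀p]; exact g₀.strictMono hpt
      have k2 : g₀ t ≤ z₂ := by rw [← hg₀q]; exact g₀.monotone htq
      have k3 : R (χ.e z₀) (χ.e (g₀ t)) (χ.e z) := χ.rel_of_lt hR (by linarith) (by linarith)
      exact hR.cyclic _ _ _ (hR.trans _ _ _ _ (hR.cyclic' hw') (hR.cyclic' k3))
    rw [hfix] at hball
    linarith
  have h3 := hinj ((key p h1).symm.trans (key q (h1.trans h2)))
  exact h2.ne (χ.injective h3)

variable [CompactSpace X] [Nonempty X]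

theorem exists_finset_forall_dist_lt (hR : IsCircularOrder R) (hd : IsDenseCircularOrder R) (o : C)
    {ε : ℝ} (hε : 0 < ε) :
    ∃ A : Finset C, o ∈ A ∧ ∀ g : ternaryAut R, (∀ a ∈ A, g • a = a) →
      ∀ x : X, dist (g • x) x < ε := by
  classical
  obtain ⟨χ⟩ := exists_circleChart hR hd o
  obtain ⟨A, hA⟩ := RatAut.exists_finset_lt
    ((isSeparableLength_displacement (G := ternaryAut R) (X := X)).comp (χ.hom hR)) hε
  refine ⟨insert o (A.image χ.e), Finset.mem_insert_self _ _, fun g hg x ↦ ?_⟩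
  obtain ⟨g', rfl⟩ := χ.exists_hom_eq hR g (hg o (Finset.mem_insert_self _ _))
  refine (dist_smul_le_displacement _ x).trans_lt (hA g' fun t ht ↦ χ.injective ?_)
  rw [← χ.hom_e hR]
  exact hg _ (Finset.mem_insert_of_mem (Finset.mem_image_of_mem _ ht))

/-- If the closed arc from a to b misses A, some automorphism fixes A pointwise and takes a to b; by
automatic continuity it moves φ a by less than ε. -/
theorem exists_finset_forall_arc (hR : IsCircularOrder R) (hd : IsDenseCircularOrder R) (o : C)
    {φ : C → X} (hφ : ∀ (g : ternaryAut R) q, φ (g • q) = g • φ q) {ε : ℝ} (hε : 0 < ε) :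
    ∃ A : Finset C, o ∈ A ∧ ∀ a b, a ≠ b → (∀ z ∈ A, z ≠ a ∧ z ≠ b ∧ ¬ R a z b) →
      dist (φ b) (φ a) < ε := by
  classical
  obtain ⟨A, ho, hA⟩ := exists_finset_forall_dist_lt (X := X) hR hd o hε
  refine ⟨A, ho, fun a b hab hz ↦ ?_⟩
  obtain ⟨χ⟩ := exists_circleChart hR hd o
  obtain ⟨hoa, hob, hoab⟩ := hz o ho
  have h1 : R o a b := by
    rcases hR.total a b o hab hob.symm hoa.symm with h | h
    · exact hR.cyclic' h
    · exact absurd h hoab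
  obtain ⟨s, rfl⟩ := χ.exists_eq a hoa.symm
  obtain ⟨t, rfl⟩ := χ.exists_eq b hob.symm
  rw [χ.rel_iff] at h1
  set A' := A.preimage χ.e χ.injective.injOn with hA'
  have hz' : ∀ z ∈ A', z ≠ s ∧ z ≠ t ∧ ¬ (s < z ∧ z < t) := by
    intro z hzA
    obtain ⟨k1, k2, k3⟩ := hz _ (Finset.mem_preimage.1 hzA)
    exact ⟨fun h ↦ k1 (h ▸ rfl), fun h ↦ k2 (h ▸ rfl), fun h ↦ k3 (χ.rel_of_lt hR h.1 h.2)⟩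
  obtain ⟨g, hg⟩ := RatAut.exists_eq_on_finset (insert s A') (fun x ↦ if x = s then t else x) (by
    intro x hx y hy hxy
    have hx' : x = s ∨ x ∈ A' := Finset.mem_insert.1 hx
    have hy' : y = s ∨ y ∈ A' := Finset.mem_insert.1 hy
    have := hz' x
    have := hz' y
    dsimp only
    grind)
  have hgs : g s = t := by simpa using hg s (Finset.mem_insert_self _ _)
  have := hA (χ.hom hR g) (fun z hzA ↦ by
    rcases χ.cases z with rfl | ⟨r, rfl⟩
    · exact χ.hom_base hR g
    · have hr : r ∈ A' := Finset.mem_preimage.2 hzA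
      rw [χ.hom_e, hg r (Finset.mem_insert_of_mem hr), if_neg (hz' r hr).1]) (φ (χ.e s))
  rwa [← hφ, χ.hom_e, hgs] at this

/-- In a chart at o, the values of φ just before o form a Cauchy net as t → ∞. Its limit is again
fixed by the stabilizer of o, hence defines a second equivariant map ψ, the left limit of φ. -/
theorem exists_leftContinuous (hR : IsCircularOrder R) (hd : IsDenseCircularOrder R) :
    ∃ ψ : C → X, (∀ (g : ternaryAut R) q, ψ (g • q) = g • ψ q) ∧ IsLeftContinuous R ψ := by
  classical
  obtain ⟨o, -⟩ := exists_pair_ne C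
  obtain ⟨χ⟩ := exists_circleChart hR hd o
  obtain ⟨x, hx⟩ := RatAut.exists_fixed (X := X) (χ.hom hR)
  obtain ⟨φ, -, hφ⟩ := exists_equivariant hR hd o (x := x) fun g hg ↦ by
    obtain ⟨g', rfl⟩ := χ.exists_hom_eq hR g hg
    exact hx g'
  have harc : ∀ ε > 0, ∃ M, ∀ s t, M < s → s < t → dist (φ (χ.e t)) (φ (χ.e s)) < ε := by
    intro ε hε
    obtain ⟨A, ho, hA⟩ := exists_finset_forall_arc hR hd o hφ hε
    obtain ⟨M, hM⟩ := (A.preimage χ.e χ.injective.injOn).bddAbove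
    refine ⟨M, fun s t hs ht ↦ hA _ _ (fun h ↦ ht.ne (χ.injective h)) fun z hz ↦ ?_⟩
    rcases χ.cases z with rfl | ⟨r, rfl⟩
    · exact ⟨(χ.ne _).symm, (χ.ne _).symm, fun h ↦
        absurd ((χ.rel_iff _ _).1 (hR.cyclic _ _ _ h)) ht.not_gt⟩
    · have hr : r ≤ M := hM (Finset.mem_preimage.2 hz)
      refine ⟨fun h ↦ ?_, fun h ↦ ?_, fun h ↦ ?_⟩
      · have := χ.injective h; linarith
      · have := χ.injective h; linarith
      · rw [χ.rel_iff' hR] at h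
        rcases h with h | h | h <;> linarith
  obtain ⟨y, hy⟩ : ∃ y, Filter.Tendsto (fun t ↦ φ (χ.e t)) Filter.atTop (nhds y) := by
    refine cauchySeq_tendsto_of_complete (Metric.cauchySeq_iff'.2 fun ε hε ↦ ?_)
    obtain ⟨M, hM⟩ := harc ε hε
    refine ⟨M + 1, fun n hn ↦ ?_⟩
    rcases hn.eq_or_lt with h | h
    · rw [← h, dist_self]; exact hε
    · exact hM _ _ (lt_add_one M) h
  obtain ⟨ψ, hψo, hψ⟩ := exists_equivariant hR hd o (x := y) fun g hg ↦ by
    obtain ⟨g', rfl⟩ := χ.exists_hom_eq hR g hg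
    refine tendsto_nhds_unique (((continuous_const_smul (χ.hom hR g')).tendsto y).comp hy)
      ((hy.comp g'.tendsto_atTop).congr fun t ↦ ?_)
    simp only [Function.comp_apply]
    rw [← hφ, χ.hom_e]
  refine ⟨ψ, hψ, ?_⟩
  have hbase : ∀ ε > 0, ∃ p, p ≠ o ∧ ∀ x, R p x o → dist (ψ x) (ψ o) < ε := by
    intro ε hε
    obtain ⟨M, hM⟩ := harc (ε / 3) (by positivity)
    set n := M + 1 with hn
    have hMn : M < n := lt_add_one M
    have ho : dist (ψ o) (φ (χ.e n)) ≤ ε / 3 := by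
      rw [hψo]
      refine le_of_tendsto (hy.dist tendsto_const_nhds) ?_
      filter_upwards [Filter.eventually_gt_atTop n] with t ht
      exact (hM _ _ hMn ht).le
    refine ⟨χ.e n, χ.ne n, fun x hx ↦ ?_⟩
    obtain ⟨t, rfl⟩ := χ.exists_eq x (hR.ne₂₃ hx)
    have hnt : n < t := (χ.rel_iff _ _).1 (hR.cyclic' hx)
    obtain ⟨k, hk⟩ := exists_smul_eq_of_circularOrder hR hd o (χ.e t)
    -- By equivariance ψ is the left limit of φ at every point, so near o both ψ x and ψ o are
    -- limits of values of φ on the arc where φ is almost constant.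
    have hlim : Filter.Tendsto (fun s ↦ φ (k • χ.e s)) Filter.atTop (nhds (ψ (χ.e t))) := by
      rw [← hk, hψ, hψo]
      simp only [hφ]
      exact ((continuous_const_smul k).tendsto y).comp hy
    obtain ⟨m, hm⟩ := χ.exists_eq (k⁻¹ • χ.e n) fun h ↦ by
      rw [inv_smul_eq_iff, hk] at h
      exact hnt.ne (χ.injective h)
    have ht : dist (ψ (χ.e t)) (φ (χ.e n)) ≤ ε / 3 := by
      refine le_of_tendsto (hlim.dist tendsto_const_nhds) ?_
      filter_upwards [Filter.eventually_gt_atTop m] with s hs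
      have h1 := (smul_rel_iff k _ _ _).2 ((χ.rel_iff _ _).2 hs)
      rw [hk, hm, smul_inv_smul] at h1
      obtain ⟨r, hr⟩ := χ.exists_eq (k • χ.e s) fun h ↦ by
        rw [h] at h1
        exact absurd ((χ.rel_iff _ _).1 (hR.cyclic' h1)) hnt.not_gt
      rw [← hr] at h1 ⊢
      rw [χ.rel_iff' hR] at h1
      refine (hM _ _ hMn ?_).le
      rcases h1 with h | h | h <;> linarith
    have := dist_triangle_right (ψ (χ.e t)) (ψ o) (φ (χ.e n))
    linarith
  intro q ε hε
  obtain ⟨k, rfl⟩ := exists_smul_eq_of_circularOrder hR hd o q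
  have hk : ContinuousAt (fun x : X ↦ k • x) (ψ o) := (continuous_const_smul k).continuousAt
  obtain ⟨δ, hδ, hkδ⟩ := Metric.continuousAt_iff.1 hk ε hε
  obtain ⟨p, hp, hpx⟩ := hbase δ hδ
  refine ⟨k • p, fun h ↦ hp (smul_left_cancel k h), fun x hx ↦ ?_⟩
  have h1 := hkδ (hpx (k⁻¹ • x) ((smul_rel_iff k _ _ _).1 (by rwa [smul_inv_smul])))
  rwa [← hψ, ← hψ, smul_inv_smul] at h1

/-- Left continuity lets b be approached from inside the arc, so b itself may belong to A.
Contrapositively, ψ-values more than ε apart force A to meet [a,b). -/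
theorem exists_finset_forall_Ico (hR : IsCircularOrder R) (hd : IsDenseCircularOrder R)
    {ψ : C → X} (hψ : ∀ (g : ternaryAut R) q, ψ (g • q) = g • ψ q) (hl : IsLeftContinuous R ψ)
    {ε : ℝ} (hε : 0 < ε) :
    ∃ A : Finset C, ∀ a b, a ≠ b → (∀ z ∈ A, z ≠ a ∧ ¬ R a z b) → dist (ψ b) (ψ a) ≤ ε := by
  obtain ⟨o, -⟩ := exists_pair_ne C
  obtain ⟨A, -, hA⟩ := exists_finset_forall_arc hR hd o hψ hε
  refine ⟨A, fun a b hab hz ↦ le_of_forall_pos_le_add fun δ hδ ↦ ?_⟩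
  obtain ⟨p, hp, hpx⟩ := hl b δ hδ
  obtain ⟨w, haw, hpw⟩ := exists_rel_and_rel hR hd hab hp
  have h1 := hpx w hpw
  have h2 := hA a w (hR.ne₁₂ haw) fun z hzA ↦
    ⟨(hz z hzA).1, fun h ↦ (hz z hzA).2 (h ▸ haw), fun h ↦ (hz z hzA).2 (hR.trans _ _ _ _ h haw)⟩
  have h3 := dist_triangle_left (ψ b) (ψ a) (ψ w)
  linarith

end Dynamics

/-! ### The interval topology -/

theorem isOpen_compl_closedArc {Y : Type*} (R : Y → Y → Y → Prop) (a b : Y) :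
    @IsOpen Y (circularIntervalTopology R) (closedArc R a b)ᶜ :=
  TopologicalSpace.isOpen_generateFrom_of_mem (Or.inl ⟨a, b, rfl⟩)

theorem notMem_closedArc {Y : Type*} {R : Y → Y → Y → Prop} {a b x : Y} :
    x ∈ (closedArc R a b)ᶜ ↔ ¬ R a x b ∧ x ≠ a ∧ x ≠ b := by
  simp only [closedArc, Set.mem_compl_iff, Set.mem_union, Set.mem_ofPred_eq, Set.mem_insert_iff,
    Set.mem_singleton_iff]
  tauto

namespace IsCircularOrder

variable {Y : Type*} {R : Y → Y → Y → Prop}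

theorem separated_of_forall_not (hR : IsCircularOrder R) {a b d : Y} (hab : ∀ c, ¬ R a c b)
    (hd : R b d a) :
    ∃ U V, @IsOpen Y (circularIntervalTopology R) U ∧ @IsOpen Y (circularIntervalTopology R) V ∧
      a ∈ U ∧ b ∈ V ∧ Disjoint U V := by
  refine ⟨_, _, isOpen_compl_closedArc R b d, isOpen_compl_closedArc R d a,
    notMem_closedArc.2 ⟨hR.not_swap hd, (hR.ne₁₃ hd).symm, (hR.ne₂₃ hd).symm⟩,
    notMem_closedArc.2 ⟨hR.not_swap (hR.cyclic _ _ _ hd), hR.ne₁₂ hd, hR.ne₁₃ hd⟩, ?_⟩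
  rw [Set.disjoint_left]
  intro x hx hx'
  rw [notMem_closedArc] at hx hx'
  have h1 := (hR.total b x d hx.2.1.symm hx.2.2 (hR.ne₁₂ hd)).resolve_left hx.1
  have h2 := (hR.total d x a hx'.2.1.symm hx'.2.2 (hR.ne₂₃ hd)).resolve_left hx'.1
  exact hab x (hR.trans_right h2 (hR.cyclic _ _ _ h1))

/-- If both open arcs between a and b contain points c and d, the complements of [c,d] and [d,c]
separate a from b. An empty arc is a jump, and then a and b themselves serve as arc endpoints. -/
theorem t2Space (hR : IsCircularOrder R) : @T2Space Y (circularIntervalTopology R) := by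
  refine @T2Space.mk Y (circularIntervalTopology R) fun a b hab ↦ ?_
  by_cases h : ∃ c, R a c b
  · by_cases h' : ∃ d, R b d a
    · obtain ⟨c, hc⟩ := h
      obtain ⟨d, hd⟩ := h'
      have h1 := hR.trans _ _ _ _ hc (hR.cyclic' hd)
      have h2 := hR.trans_right hc (hR.cyclic' hd)
      refine ⟨_, _, isOpen_compl_closedArc R c d, isOpen_compl_closedArc R d c,
        notMem_closedArc.2 ⟨hR.not_swap (hR.cyclic _ _ _ h1), hR.ne₁₂ hc, (hR.ne₂₃ hd).symm⟩,
        notMem_closedArc.2 ⟨hR.not_swap (hR.cyclic' h2), hR.ne₁₂ hd, (hR.ne₂₃ hc).symm⟩, ?_⟩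
      rw [Set.disjoint_left]
      intro x hx hx'
      rw [notMem_closedArc] at hx hx'
      rcases hR.total c x d hx.2.1.symm hx.2.2 (hR.ne₁₃ h2) with h3 | h3
      · exact hx.1 h3
      · exact hx'.1 (hR.cyclic _ _ _ h3)
    · obtain ⟨c, hc⟩ := h
      obtain ⟨U, V, hU, hV, hbU, haV, hUV⟩ :=
        hR.separated_of_forall_not (fun d hd ↦ h' ⟨d, hd⟩) hc
      exact ⟨V, U, hV, hU, haV, hbU, hUV.symm⟩
  · by_cases h' : ∃ d, R b d a
    · obtain ⟨d, hd⟩ := h'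
      exact hR.separated_of_forall_not (fun c hc ↦ h ⟨c, hc⟩) hd
    · refine ⟨_, _, isOpen_compl_closedArc R b b, isOpen_compl_closedArc R a a,
        notMem_closedArc.2 ⟨fun h ↦ hR.ne₁₃ h rfl, hab, hab⟩,
        notMem_closedArc.2 ⟨fun h ↦ hR.ne₁₃ h rfl, hab.symm, hab.symm⟩, ?_⟩
      rw [Set.disjoint_left]
      intro x hx hx'
      rw [notMem_closedArc] at hx hx'
      rcases hR.total a x b hx'.2.1.symm hx.2.1 hab with h3 | h3
      · exact h ⟨x, h3⟩
      · exact h' ⟨x, hR.cyclic _ _ _ h3⟩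

/-- A compact topology is the interval topology of every circular order with closed arcs. -/
theorem eq_circularIntervalTopology (hR : IsCircularOrder R) [t : TopologicalSpace Y]
    [CompactSpace Y] (h : ∀ a b, IsClosed (closedArc R a b)) :
    t = circularIntervalTopology R := by
  have hle : t ≤ circularIntervalTopology R := by
    refine le_generateFrom ?_
    rintro _ (⟨a, b, rfl⟩ | rfl)
    · exact (h a b).isOpen_compl
    · exact isOpen_univ
  refine le_antisymm hle ?_
  have hT2 := hR.t2Space
  -- The identity is continuous from a compact to a Hausdorff topology, hence closed.
  have hc : @IsClosedMap Y Y t (circularIntervalTopology R) id :=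
    @Continuous.isClosedMap Y Y t (circularIntervalTopology R) _ hT2 id
      (continuous_id_iff_le.2 hle)
  intro U hU
  have h1 := hc Uᶜ (isClosed_compl_iff.2 hU)
  rw [Set.image_id] at h1
  exact (@isClosed_compl_iff Y (circularIntervalTopology R) U).1 h1

end IsCircularOrder

/-! ### The order on the closure of the image of the circle -/

/-- Three points are in order if all triples of points of the circle that are mapped close to them
are. -/
def limitOrder {C X : Type*} [TopologicalSpace X] (R : C → C → C → Prop) (ψ : C → X) (x y z : X) :
    Prop :=
  ∃ U ∈ nhds x, ∃ V ∈ nhds y, ∃ W ∈ nhds z, ∀ a b c, ψ a ∈ U → ψ b ∈ V → ψ c ∈ W → R a b c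

theorem limitOrder_smul {C X : Type*} {R : C → C → C → Prop} [MetricSpace X]
    [MulAction (ternaryAut R) X] [ContinuousConstSMul (ternaryAut R) X]
    {ψ : C → X} (hψ : ∀ (g : ternaryAut R) q, ψ (g • q) = g • ψ q)
    (g : ternaryAut R) {x y z : X} (h : limitOrder R ψ x y z) :
    limitOrder R ψ (g • x) (g • y) (g • z) := by
  obtain ⟨U, hU, V, hV, W, hW, h⟩ := h
  have hn : ∀ {x : X} {U : Set X}, U ∈ nhds x → {y | g⁻¹ • y ∈ U} ∈ nhds (g • x) := by
    intro x U hU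
    refine (continuous_const_smul g⁻¹).continuousAt ?_
    rwa [inv_smul_smul]
  refine ⟨_, hn hU, _, hn hV, _, hn hW, fun a b c ha hb hc ↦ ?_⟩
  rw [Set.mem_ofPred_eq, ← hψ] at ha hb hc
  exact (smul_rel_iff _ _ _ _).1 (h _ _ _ ha hb hc)

/-- Cut points in the four consecutive arcs [a,b), [b,a'), [a',c), [c,a) place a and a' in half-open
arcs that are apart, as `disjoint_closure_image_arcIoc` requires. -/
theorem IsCircularOrder.interlaced {C : Type*} {R : C → C → C → Prop} (hR : IsCircularOrder R)
    {a b a' c p q p' q' : C} (h₁ : R a b a') (h₂ : R a' c a) (hq : q = a ∨ R a q b)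
    (hp' : p' = b ∨ R b p' a') (hq' : q' = a' ∨ R a' q' c) (hp : p = c ∨ R c p a) :
    R p' q' p ∧ R p' p q ∧ a ∈ arcIoc R p q ∧ a' ∈ arcIoc R p' q' := by
  have i1 : R a p' a' := by
    rcases hp' with rfl | h
    · exact h₁
    · exact hR.cyclic _ _ _ (hR.trans _ _ _ _ (hR.cyclic' h₁) (hR.cyclic' h))
  have i2 : R a' p a := by
    rcases hp with rfl | h
    · exact h₂
    · exact hR.cyclic _ _ _ (hR.trans _ _ _ _ (hR.cyclic' h₂) (hR.cyclic' h))
  have i3 : q = a ∨ R a q p' := by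
    refine hq.imp_right fun h ↦ ?_
    rcases hp' with rfl | h'
    · exact h
    · exact hR.trans _ _ _ _ h (hR.trans_right (hR.cyclic' h₁) (hR.cyclic' h'))
  have i4 : q' = a' ∨ R a' q' p := by
    refine hq'.imp_right fun h ↦ ?_
    rcases hp with rfl | h'
    · exact h
    · exact hR.trans _ _ _ _ h (hR.trans_right (hR.cyclic' h₂) (hR.cyclic' h'))
  have j1 : R a' p p' := hR.trans _ _ _ _ i2 (hR.cyclic' i1)
  have j2 : R p a p' := hR.trans_right i2 (hR.cyclic' i1)
  have k1 : R p' q' p ∧ a' ∈ arcIoc R p' q' := by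
    rcases i4 with rfl | h
    · exact ⟨hR.cyclic' j1, Or.inr rfl⟩
    · exact ⟨hR.cyclic' (hR.trans_right h j1), Or.inl (hR.cyclic' (hR.trans _ _ _ _ h j1))⟩
  have k2 : R p' p q ∧ a ∈ arcIoc R p q := by
    rcases i3 with rfl | h
    · exact ⟨hR.cyclic' j2, Or.inr rfl⟩
    · have j3 := hR.cyclic _ _ _ j2
      exact ⟨hR.cyclic _ _ _ (hR.trans_right h j3), Or.inl (hR.cyclic' (hR.trans _ _ _ _ h j3))⟩
  exact ⟨k1.1, k2.1, k2.2, k1.2⟩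

section LimitOrder

variable {C : Type*} [Countable C] [Nontrivial C] {R : C → C → C → Prop}
  {X : Type*} [MetricSpace X] [CompactSpace X] [Nonempty X] [MulAction (ternaryAut R) X]
  [ContinuousConstSMul (ternaryAut R) X]

/-- A flip puts x and x' on different sides of u and v. Since all four gaps are ε-large in X, a
fixed finite set A cuts each of them, so x and x' lie in arcs with endpoints in A whose images have
disjoint closures. Now y misses one of the two closures, and only finitely many quadruples from A
have to be avoided. -/
theorem exists_nhds_no_flip (hR : IsCircularOrder R) (hd : IsDenseCircularOrder R)
    {ψ : C → X} (hψ : ∀ (g : ternaryAut R) q, ψ (g • q) = g • ψ q) (hl : IsLeftContinuous R ψ)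
    (hinj : Function.Injective ψ) {ε : ℝ} (hε : 0 < ε) (y : X) :
    ∃ V ∈ nhds y, V ⊆ Metric.ball y ε ∧ ∀ x x' u v, ψ x ∈ V → ψ x' ∈ V →
      (∀ z ∈ V, ε < dist z (ψ u) ∧ ε < dist z (ψ v)) → R x u v → ¬ R x' v u := by
  obtain ⟨A, hA⟩ := exists_finset_forall_Ico hR hd hψ hl hε
  have hA : ∀ a b, ε < dist (ψ b) (ψ a) → ∃ z ∈ A, z = a ∨ R a z b := by
    intro a b hab
    by_contra! h
    have hne : a ≠ b := fun e ↦ by rw [e, dist_self] at hab; linarith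
    exact absurd (hA a b hne h) (not_le.2 hab)
  have hW : ∀ p q p' q' : C, ∃ W ∈ nhds y, R p' q' p → R p' p q → ∀ a a', ψ a ∈ W → ψ a' ∈ W →
      a ∈ arcIoc R p q → a' ∉ arcIoc R p' q' := by
    intro p q p' q'
    by_cases h : R p' q' p ∧ R p' p q
    · have hdis := disjoint_closure_image_arcIoc hR hd hψ hl hinj h.1 h.2
      by_cases hy : y ∈ closure (ψ '' arcIoc R p q)
      · refine ⟨_, isClosed_closure.isOpen_compl.mem_nhds (Set.disjoint_left.1 hdis hy),
          fun _ _ a a' _ ha' _ haa' ↦ ha' (subset_closure ⟨a', haa', rfl⟩)⟩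
      · exact ⟨_, isClosed_closure.isOpen_compl.mem_nhds hy,
          fun _ _ a a' ha _ haa _ ↦ ha (subset_closure ⟨a, haa, rfl⟩)⟩
    · exact ⟨Set.univ, Filter.univ_mem, fun h1 h2 ↦ absurd ⟨h1, h2⟩ h⟩
  choose W hW hW' using hW
  refine ⟨Metric.ball y ε ∩ ⋂ p ∈ A, ⋂ q ∈ A, ⋂ p' ∈ A, ⋂ q' ∈ A, W p q p' q',
    Filter.inter_mem (Metric.ball_mem_nhds y hε) ?_, Set.inter_subset_left, ?_⟩
  · refine (Filter.biInter_finset_mem A).2 fun p _ ↦ (Filter.biInter_finset_mem A).2 fun q _ ↦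
      (Filter.biInter_finset_mem A).2 fun p' _ ↦ (Filter.biInter_finset_mem A).2 fun q' _ ↦ hW _ _ _ _
  · intro x x' u v hx hx' huv h1 h2
    have j1 : R x u x' := hR.cyclic' (hR.trans _ _ _ _ (hR.cyclic' h2) (hR.cyclic _ _ _ h1))
    have j2 : R x' v x := hR.trans_right (hR.cyclic' h2) (hR.cyclic _ _ _ h1)
    obtain ⟨q, hqA, hq⟩ := hA x u (by rw [dist_comm]; exact (huv _ hx).1)
    obtain ⟨p', hpA', hp'⟩ := hA u x' (huv _ hx').1
    obtain ⟨q', hqA', hq'⟩ := hA x' v (by rw [dist_comm]; exact (huv _ hx').2)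
    obtain ⟨p, hpA, hp⟩ := hA v x (huv _ hx).2
    obtain ⟨k1, k2, k3, k4⟩ := hR.interlaced j1 j2 hq hp' hq' hp
    have hmem : ∀ z ∈ Metric.ball y ε ∩ ⋂ p ∈ A, ⋂ q ∈ A, ⋂ p' ∈ A, ⋂ q' ∈ A, W p q p' q',
        z ∈ W p q p' q' := by
      intro z hz
      have := hz.2
      simp only [Set.mem_iInter] at this
      exact this p hpA q hqA p' hpA' q' hqA'
    exact hW' p q p' q' k1 k2 x x' (hmem _ hx) (hmem _ hx') k3 k4

/-- Changing a triple near (x,y,z) one entry at a time never reverses its orientation, by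
`exists_nhds_no_flip` at x, y and z in turn. So all nearby triples have the same orientation. -/
theorem limitOrder_total (hR : IsCircularOrder R) (hd : IsDenseCircularOrder R)
    {ψ : C → X} (hψ : ∀ (g : ternaryAut R) q, ψ (g • q) = g • ψ q) (hl : IsLeftContinuous R ψ)
    (hinj : Function.Injective ψ) {x y z : X} (hxy : x ≠ y) (hyz : y ≠ z) (hxz : x ≠ z) :
    limitOrder R ψ x y z ∨ limitOrder R ψ x z y := by
  obtain ⟨ε, hε, h1, h2, h3⟩ : ∃ ε > 0, 3 * ε ≤ dist x y ∧ 3 * ε ≤ dist y z ∧ 3 * ε ≤ dist x z := by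
    refine ⟨min (dist x y) (min (dist y z) (dist x z)) / 3, ?_, ?_, ?_, ?_⟩
    · have := dist_pos.2 hxy
      have := dist_pos.2 hyz
      have := dist_pos.2 hxz
      positivity
    · have := min_le_left (dist x y) (min (dist y z) (dist x z)); linarith
    · have := (min_le_right (dist x y) _).trans (min_le_left (dist y z) (dist x z)); linarith
    · have := (min_le_right (dist x y) _).trans (min_le_right (dist y z) (dist x z)); linarith
  obtain ⟨U, hU, hUb, hUf⟩ := exists_nhds_no_flip hR hd hψ hl hinj hε x
  obtain ⟨V, hV, hVb, hVf⟩ := exists_nhds_no_flip hR hd hψ hl hinj hε y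
  obtain ⟨W, hW, hWb, hWf⟩ := exists_nhds_no_flip hR hd hψ hl hinj hε z
  have far : ∀ {s t s' t' : X}, 3 * ε ≤ dist s t → dist s' s < ε → dist t' t < ε →
      ε < dist s' t' := by
    intro s t s' t' h hs ht
    have k1 := dist_triangle4 s s' t' t
    rw [dist_comm s s'] at k1
    linarith
  have hUV : ∀ s ∈ U, ∀ t ∈ V, ε < dist s t := fun s hs t ht ↦ far h1 (hUb hs) (hVb ht)
  have hVW : ∀ s ∈ V, ∀ t ∈ W, ε < dist s t := fun s hs t ht ↦ far h2 (hVb hs) (hWb ht)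
  have hUW : ∀ s ∈ U, ∀ t ∈ W, ε < dist s t := fun s hs t ht ↦ far h3 (hUb hs) (hWb ht)
  have hVU : ∀ s ∈ V, ∀ t ∈ U, ε < dist s t := fun s hs t ht ↦ by
    rw [dist_comm]; exact hUV t ht s hs
  have hWV : ∀ s ∈ W, ∀ t ∈ V, ε < dist s t := fun s hs t ht ↦ by
    rw [dist_comm]; exact hVW t ht s hs
  have hWU : ∀ s ∈ W, ∀ t ∈ U, ε < dist s t := fun s hs t ht ↦ by
    rw [dist_comm]; exact hUW t ht s hs
  have hne : ∀ {a b : C}, ε < dist (ψ a) (ψ b) → a ≠ b := fun h e ↦ by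
    rw [e, dist_self] at h; linarith
  have htot : ∀ a b c, ψ a ∈ U → ψ b ∈ V → ψ c ∈ W → R a b c ∨ R a c b := fun a b c ha hb hc ↦
    hR.total a b c (hne (hUV _ ha _ hb)) (hne (hVW _ hb _ hc)) (hne (hUW _ ha _ hc))
  by_contra! hcon
  obtain ⟨hcon1, hcon2⟩ := hcon
  obtain ⟨a, b, c, ha, hb, hc, habc⟩ : ∃ a b c, ψ a ∈ U ∧ ψ b ∈ V ∧ ψ c ∈ W ∧ ¬ R a b c := by
    by_contra! h
    exact hcon1 ⟨U, hU, V, hV, W, hW, h⟩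
  obtain ⟨a', b', c', ha', hb', hc', habc'⟩ :
      ∃ a b c, ψ a ∈ U ∧ ψ b ∈ V ∧ ψ c ∈ W ∧ ¬ R a c b := by
    by_contra! h
    exact hcon2 ⟨U, hU, W, hW, V, hV, fun a c b ha hc hb ↦ h a b c ha hb hc⟩
  have s0 := (htot a' b' c' ha' hb' hc').resolve_right habc'
  have s1 : R a b' c' := (htot a b' c' ha hb' hc').resolve_right
    (hUf a' a b' c' ha' ha (fun s hs ↦ ⟨hUV s hs _ hb', hUW s hs _ hc'⟩) s0)
  have s2 : R a b c' := (htot a b c' ha hb hc').resolve_right fun h ↦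
    hVf b' b c' a hb' hb (fun s hs ↦ ⟨hVW s hs _ hc', hVU s hs _ ha⟩) (hR.cyclic _ _ _ s1)
      (hR.cyclic' h)
  have s3 : R a b c := (htot a b c ha hb hc).resolve_right fun h ↦
    hWf c' c a b hc' hc (fun s hs ↦ ⟨hWU s hs _ ha, hWV s hs _ hb⟩) (hR.cyclic' s2)
      (hR.cyclic _ _ _ h)
  exact habc s3

/-- Asymmetry and transitivity need points of the image near each point of S, hence the closure;
only totality uses the dynamics. -/
theorem isCircularOrder_limitOrder (hR : IsCircularOrder R) (hd : IsDenseCircularOrder R)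
    {ψ : C → X} (hψ : ∀ (g : ternaryAut R) q, ψ (g • q) = g • ψ q) (hl : IsLeftContinuous R ψ)
    (hinj : Function.Injective ψ) {S : Set X} (hS : S ⊆ closure (Set.range ψ)) :
    IsCircularOrder fun x y z : S ↦ limitOrder R ψ (x : X) y z := by
  have hex : ∀ (x : S) U, U ∈ nhds (x : X) → ∃ a, ψ a ∈ U := fun x U hU ↦ by
    obtain ⟨_, h, a, rfl⟩ := mem_closure_iff_nhds.1 (hS x.2) U hU
    exact ⟨a, h⟩
  refine ⟨fun x y z ↦ ?_, fun x y z ↦ ?_, fun x y z w ↦ ?_, fun x y z hxy hyz hxz ↦ ?_⟩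
  · rintro ⟨U, hU, V, hV, W, hW, h⟩
    exact ⟨V, hV, W, hW, U, hU, fun b c a hb hc ha ↦ hR.cyclic _ _ _ (h a b c ha hb hc)⟩
  · rintro ⟨U, hU, V, hV, W, hW, h⟩ ⟨V', hV', U', hU', W', hW', h'⟩
    obtain ⟨a, ha, ha'⟩ := hex x _ (Filter.inter_mem hU hU')
    obtain ⟨b, hb, hb'⟩ := hex y _ (Filter.inter_mem hV hV')
    obtain ⟨c, hc, hc'⟩ := hex z _ (Filter.inter_mem hW hW')
    exact hR.asymm _ _ _ (h a b c ha hb hc) (h' b a c hb' ha' hc')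
  · rintro ⟨U, hU, V, hV, W, hW, h⟩ ⟨U', hU', W', hW', Z, hZ, h'⟩
    obtain ⟨c, hc, hc'⟩ := hex z _ (Filter.inter_mem hW hW')
    exact ⟨U ∩ U', Filter.inter_mem hU hU', V, hV, Z, hZ, fun a b d ha hb hd' ↦
      hR.trans _ _ _ _ (h a b c ha.1 hb hc) (h' a c d ha.2 hc' hd')⟩
  · exact limitOrder_total hR hd hψ hl hinj (Subtype.coe_injective.ne hxy)
      (Subtype.coe_injective.ne hyz) (Subtype.coe_injective.ne hxz)

/-- Every action of the automorphism group of a countable dense circular order on a nonempty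
compact metric space has a circularly ordered subsystem. -/
theorem hasCircularlyOrderedSubsystem (hR : IsCircularOrder R) (hd : IsDenseCircularOrder R) :
    HasCircularlyOrderedSubsystem (ternaryAut R) X := by
  obtain ⟨ψ, hψ, hl⟩ := exists_leftContinuous (X := X) hR hd
  obtain ⟨o, -⟩ := exists_pair_ne C
  rcases injective_or_constant hR hd hψ with hinj | hconst
  · let Y : SubMulAction (ternaryAut R) X :=
      { carrier := closure (Set.range ψ)
        smul_mem' := fun g x hx ↦ by
          refine map_mem_closure (continuous_const_smul g) hx ?_
          rintro _ ⟨q, rfl⟩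
          exact ⟨g • q, hψ g q⟩ }
    have hYc : IsClosed (Y : Set X) := isClosed_closure
    have : CompactSpace Y := isCompact_iff_compactSpace.1 hYc.isCompact
    have hO := isCircularOrder_limitOrder hR hd hψ hl hinj (S := (Y : Set X)) subset_rfl
    refine ⟨Y, ⟨ψ o, subset_closure ⟨o, rfl⟩⟩, hYc, fun x y z ↦ limitOrder R ψ x y z, hO, ?_,
      fun g a b c h ↦ limitOrder_smul hψ g h⟩
    refine hO.eq_circularIntervalTopology (Y := Y) fun a b ↦ ?_
    rw [← isOpen_compl_iff, isOpen_iff_mem_nhds]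
    intro x hx
    rw [notMem_closedArc] at hx
    by_cases hab : a = b
    · subst hab
      filter_upwards [isOpen_compl_singleton.mem_nhds hx.2.1] with x' hx'
      exact notMem_closedArc.2 ⟨fun h ↦ hO.ne₁₃ h rfl, hx', hx'⟩
    -- A point x off the arc [a,b] satisfies [a,b,x], which by the definition of `limitOrder` is an
    -- open condition on x.
    · obtain ⟨U, hU, V, hV, W, hW, h⟩ :=
        (hO.total a x b (Ne.symm hx.2.1) hx.2.2 hab).resolve_left hx.1
      filter_upwards [continuous_subtype_val.continuousAt.eventually
        (eventually_mem_nhds_iff.2 hW)] with x' hx'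
      have hx'' : limitOrder R ψ (a : X) b x' := ⟨U, hU, V, hV, W, hx', h⟩
      exact notMem_closedArc.2 ⟨hO.not_swap hx'', (hO.ne₁₃ hx'').symm, (hO.ne₂₃ hx'').symm⟩
  · let Y : SubMulAction (ternaryAut R) X :=
      { carrier := {ψ o}
        smul_mem' := fun g x hx ↦ by
          rw [Set.mem_singleton_iff] at hx ⊢
          rw [hx, ← hψ]
          exact hconst _ _ }
    have hsub : Subsingleton Y := ⟨fun x y ↦ Subtype.ext
      ((Set.mem_singleton_iff.1 x.2).trans (Set.mem_singleton_iff.1 y.2).symm)⟩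
    -- A fixed point is circularly ordered by the empty relation.
    refine ⟨Y, ⟨ψ o, rfl⟩, isClosed_singleton, fun _ _ _ ↦ False,
      ⟨fun _ _ _ h ↦ h, fun _ _ _ h ↦ h.elim, fun _ _ _ _ h ↦ h.elim,
        fun a b _ h ↦ absurd (Subsingleton.elim a b) h⟩, Subsingleton.elim _ _,
      fun _ _ _ _ h ↦ h⟩

end LimitOrder

/-! ### The rational circle -/

theorem RationalCircle.isDenseCircularOrder : IsDenseCircularOrder RationalCircle.order := by
  intro a b hab
  obtain ⟨α, rfl⟩ := QuotientAddGroup.mk_surjective a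
  obtain ⟨β', rfl⟩ := QuotientAddGroup.mk_surjective b
  -- Replace the lift of b by the representative β in [α, α + 1); the midpoint of α and β then lies
  -- on the arc from a to b.
  have hp : (0 : ℚ) < 1 := one_pos
  obtain ⟨h, z, hz⟩ := (toIcoMod_eq_iff hp (a := α) (b := β') (c := toIcoMod hp α β')).1 rfl
  set β := toIcoMod hp α β' with hβ
  have hb : ((β' : ℚ) : RationalCircle) = (β : RationalCircle) := by
    rw [hz]
    refine (QuotientAddGroup.eq_iff_sub_mem).2 ⟨z, ?_⟩
    simp
  have hlt : α < β := by
    refine lt_of_le_of_ne h.1 fun e ↦ hab ?_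
    rw [e]
    exact hb.symm
  have hlt' : β < α + 1 := h.2
  refine ⟨(((α + β) / 2 : ℚ) : RationalCircle), ?_⟩
  unfold RationalCircle.order
  rw [sbtw_iff_not_btw]
  intro hbtw
  have h1 : btw ((α : ℚ) : RationalCircle) (β' : RationalCircle)
    (((α + β) / 2 : ℚ) : RationalCircle) := hbtw.cyclic_left.cyclic_left
  rw [hb] at h1
  have h2 := QuotientAddGroup.btw_coe_iff.1 h1
  rw [(toIcoMod_eq_self _).2 ⟨hlt.le, hlt'⟩,
    (toIocMod_eq_self _).2 ⟨by linarith, by linarith⟩] at h2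
  linarith

instance : Countable RationalCircle := QuotientAddGroup.mk_surjective.countable

instance : Nontrivial RationalCircle := by
  refine ⟨((1 / 2 : ℚ) : RationalCircle), 0, fun h ↦ ?_⟩
  obtain ⟨n, hn⟩ := (AddCircle.coe_eq_zero_iff (1 : ℚ)).1 h
  have h2 : ((2 * n : ℤ) : ℚ) = (1 : ℤ) := by
    push_cast
    rw [zsmul_one] at hn
    linarith
  have := Int.cast_injective h2
  omega

theorem corollary6p2 :
    (∀ (X : Type u) [MetricSpace X] [CompactSpace X] [Nonempty X]
      [MulAction AutRationalCircle X] [ContinuousConstSMul AutRationalCircle X],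
      HasCircularlyOrderedSubsystem AutRationalCircle X) ∧
    MetricallyIntrinsicallyCOrdered.{u, 0} AutRationalCircle (⊥ : TopologicalSpace _) := by
  constructor
  · intro X _ _ _ _ _
    exact hasCircularlyOrderedSubsystem RationalCircle.isCircularOrder
      RationalCircle.isDenseCircularOrder
  · intro X _ _ _ _ _ _
    let := TopologicalSpace.metrizableSpaceMetric X
    let : TopologicalSpace AutRationalCircle := ⊥
    have : ContinuousConstSMul AutRationalCircle X := ContinuousSMul.continuousConstSMul
    exact hasCircularlyOrderedSubsystem RationalCircle.isCircularOrder
      RationalCircle.isDenseCircularOrder
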